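/- For $\xi,\eta\in\mathbb R^{2\times2}$ write $\xi:\eta=\operatorname{tr}(\xi^T\eta)$ and $|\xi|=(\xi:\xi)^{1/2}$. Let $k\in\mathbb R$, let $g(\xi)=|\xi|^4+k(\det\xi)^2$ on $\mathbb R^{2\times 2}$, let $Dg$ be its gradient map, and let $\Omega\subset\mathbb R^2$ be a bounded domain. For $1\le p<\infty$, $W^{1,p}_0(\Omega;\mathbb R^2)$ is the closure of $C_0^\infty(\Omega;\mathbb R^2)$ in $W^{1,p}(\Omega;\mathbb R^2)$, and $W^{1,\infty}_0=W^{1,\infty}\cap W^{1,1}_0$. Call $g$ integral convex if $\mathbf F(u)=\int_\Omega g(Du)\,dx$ (which is finite on $W^{1,\infty}_0(\Omega;\mathbb R^2)$) is convex on $W^{1,\infty}_0(\Omega;\mathbb R^2)$. Call a continuous map $A:\mathbb R^{2\times2}\to\mathbb R^{2\times2}$ quasimonotone if $\int_G A(\xi+D\phi):D\phi\,dx\ge0$ for every nonempty bounded open $G\subset\mathbb R^2$, every $\xi\in\mathbb R^{2\times 2}$ and every $\phi\in C_0^\infty(G;\mathbb R^2)$, and call $A$ strongly quasimonotone on $W^{1,4}_0(\Omega;\mathbb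 R^2)$ if there is $c>0$ with $\int_\Omega A(\xi+D\phi):D\phi\,dx\ge c\int_\Omega|D\phi|^4\,dx$ for all $\xi\in\mathbb R^{2\times 2}$ and $\phi\in W^{1,4}_0(\Omega;\mathbb R^2)$. Then: (i) If $0\le k\le 8$, then $Dg$ is quasimonotone; in fact, for all $\xi\in\mathbb R^{2\times2}$ and $\phi\in W^{1,4}_0(\Omega;\mathbb R^2)$, both integrands below are integrable on $\Omega$ and $$\int_\Omega Dg(\xi+D\phi):D\phi\,dx\ \ge\ \frac{8-k}{8}\int_\Omega|D\phi|^4\,dx .$$ Hence, if $0\le k<8$, then $Dg$ is strongly quasimonotone on $W^{1,4}_0(\Omega;\mathbb R^2)$. (ii) $g$ is integral convex if and only if $-2\le k\le 4$, in which case $g$ is in fact convex. Therefore, if $4<k\le 8$, then $Dg$ is quasimonotone but $g$ is not integral convex. -/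

import Mathlib

open MeasureTheory Filter Topology
open scoped ENNReal ContDiff

noncomputable section

namespace IntegralConvexity

/-- Euclidean space `ℝⁿ`. -/
abbrev E (n : ℕ) : Type := EuclideanSpace ℝ (Fin n)

/-- The space `ℝ^{N×n}` of real matrices. -/
abbrev Mat (N n : ℕ) : Type := Matrix (Fin N) (Fin n) ℝ

/-- The inner product `ξ : η = tr(ξᵀ η)`. -/
def frobInner {N n : ℕ} (ξ η : Mat N n) : ℝ := (ξ.transpose * η).trace

/-- The Euclidean norm `|ξ| = (ξ : ξ)^{1/2}`. -/
def frobNorm {N n : ℕ} (ξ : Mat N n) : ℝ := Real.sqrt (frobInner ξ ξ)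

/-- The gradient map `Df : ℝ^{N×n} → ℝ^{N×n}`, the matrix of the partial derivatives
`∂f/∂ξ_{ij}`. -/
def matGrad {N n : ℕ} (f : Mat N n → ℝ) (ξ : Mat N n) : Mat N n :=
  Matrix.of fun i j => lineDeriv ℝ f ξ (Matrix.single i j 1)

/-- The classical Jacobian matrix `(∂uⁱ/∂xⱼ)` of a differentiable map. -/
def jacobian {n N : ℕ} (u : E n → E N) (x : E n) : Mat N n :=
  Matrix.of fun i j => fderiv ℝ u x (EuclideanSpace.single j 1) i

/-- `φ ∈ C₀^∞(Ω)`: smooth with compact support contained in `Ω`. -/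
structure IsTest {n : ℕ} {F : Type*} [NormedAddCommGroup F] [NormedSpace ℝ F]
    (Ω : Set (E n)) (φ : E n → F) : Prop where
  smooth : ContDiff ℝ ∞ φ
  compactSupport : HasCompactSupport φ
  support_subset : tsupport φ ⊆ Ω

/-- `U` is a Jacobian matrix of weak derivatives of `u` on `Ω`. -/
structure IsWeakGrad {n N : ℕ} (Ω : Set (E n)) (u : E n → E N) (U : E n → Mat N n) : Prop where
  locInt : LocallyIntegrableOn u Ω volume
  locIntGrad : ∀ i j, LocallyIntegrableOn (fun x => U x i j) Ω volume
  integral_eq : ∀ φ : E n → ℝ, IsTest Ω φ → ∀ i j,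
    ∫ x in Ω, u x i * fderiv ℝ φ x (EuclideanSpace.single j 1) = -∫ x in Ω, U x i j * φ x

open Classical in
/-- The weak Jacobian matrix `Du` (unique up to null subsets of the open set `Ω`), with the
value `0` if `u` is not weakly differentiable on `Ω`. -/
def weakGrad {n N : ℕ} (Ω : Set (E n)) (u : E n → E N) : E n → Mat N n :=
  if h : ∃ U, IsWeakGrad Ω u U then h.choose else 0

/-- The Sobolev space `W^{1,p}(Ω; ℝᴺ)`. -/
def W1 {n : ℕ} (N : ℕ) (Ω : Set (E n)) (p : ℝ≥0∞) : Set (E n → E N) :=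
  {u | MemLp u p (volume.restrict Ω) ∧ (∃ U, IsWeakGrad Ω u U) ∧
    ∀ i j, MemLp (fun x => weakGrad Ω u x i j) p (volume.restrict Ω)}

/-- `u` is the limit in the `W^{1,p}(Ω)` norm of a sequence in `C₀^∞(Ω; ℝᴺ)`. -/
def IsTestLimit {n N : ℕ} (Ω : Set (E n)) (p : ℝ≥0∞) (u : E n → E N) : Prop :=
  ∃ φ : ℕ → E n → E N, (∀ m, IsTest Ω (φ m)) ∧
    Tendsto (fun m => eLpNorm (fun x => φ m x - u x) p (volume.restrict Ω)) atTop (𝓝 0) ∧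
    ∀ i j, Tendsto (fun m => eLpNorm (fun x => jacobian (φ m) x i j - weakGrad Ω u x i j) p
      (volume.restrict Ω)) atTop (𝓝 0)

/-- The space `W₀^{1,p}(Ω; ℝᴺ)`. For `p < ∞` it is the closure of `C₀^∞(Ω; ℝᴺ)` in `W^{1,p}`; for
`p = ∞` it is, as usual in the calculus of variations, `W^{1,∞} ∩ W₀^{1,1}` (`Ω` bounded), so that
it contains the Lipschitz and piecewise affine maps with zero boundary values. -/
def W10 {n : ℕ} (N : ℕ) (Ω : Set (E n)) (p : ℝ≥0∞) : Set (E n → E N) :=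
  {u | u ∈ W1 N Ω p ∧ IsTestLimit Ω (if p = ⊤ then 1 else p) u}

/-- The functional `F(u) = ∫_Ω f(Du) dx`. -/
def energy {n N : ℕ} (Ω : Set (E n)) (f : Mat N n → ℝ) (u : E n → E N) : ℝ :=
  ∫ x in Ω, f (weakGrad Ω u x)

/-- Integral convexity of a continuous `f = f(ξ)` on a bounded open set `Ω`: the functional
`F(u) = ∫_Ω f(Du) dx`, which is finite on `W₀^{1,∞}(Ω; ℝᴺ)`, is convex there. -/
def IntegralConvex {n N : ℕ} (Ω : Set (E n)) (f : Mat N n → ℝ) : Prop :=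
  ConvexOn ℝ (W10 N Ω ⊤) (energy Ω f)

/-- Quasimonotonicity of a continuous map `A : ℝ^{N×n} → ℝ^{N×n}`. -/
def Quasimonotone {n N : ℕ} (A : Mat N n → Mat N n) : Prop :=
  ∀ G : Set (E n), IsOpen G → Bornology.IsBounded G → G.Nonempty →
    ∀ (ξ : Mat N n) (φ : E n → E N), IsTest G φ →
      0 ≤ ∫ x in G, frobInner (A (ξ + jacobian φ x)) (jacobian φ x)

/-- Strong quasimonotonicity of `A` on `W₀^{1,p}(Ω; ℝᴺ)`, for `1 ≤ p < ∞` and continuous `A` of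
growth at most `p - 1`. -/
def StronglyQuasimonotone {n N : ℕ} (Ω : Set (E n)) (p : ℝ) (A : Mat N n → Mat N n) : Prop :=
  ∃ c : ℝ, 0 < c ∧ ∀ (ξ : Mat N n), ∀ φ ∈ W10 N Ω (ENNReal.ofReal p),
    c * ∫ x in Ω, frobNorm (weakGrad Ω φ x) ^ p ≤
      ∫ x in Ω, frobInner (A (ξ + weakGrad Ω φ x)) (weakGrad Ω φ x)

/-- The function `g(ξ) = |ξ|⁴ + k (det ξ)²` on `ℝ^{2×2}`. -/
def g (k : ℝ) (ξ : Mat 2 2) : ℝ := frobNorm ξ ^ 4 + k * ξ.det ^ 2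

end IntegralConvexity

end

open IntegralConvexity

open IntegralConvexity

namespace IntegralConvexity

/-! Quasimonotonicity rests on null Lagrangians: `ξ : Dφ`, `cof ξ : Dφ` and `det Dφ` have zero
integral over the domain. Once these are subtracted from `Dg(ξ + η) : η`, completing two squares and
using `|ξ : η| ≤ |ξ||η|` and `2|det η| ≤ |η|²` leaves at least `(8 - k)/8 |η|⁴`
(`le_frobInner_matGrad_g`). The integrals vanish for test fields by integration by parts and on
`W₀^{1,4}` by density (`integral_weakGrad_eq_zero`).

For `-2 ≤ k ≤ 4` the function is convex pointwise. Its second variation is affine in `k`, so it is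
enough to check `k = 4`, where the determinant bound suffices, and `k = -2`, where it is a sum of
squares (`secondVar_nonneg`).

Conversely, convexity of the functional makes the integrated second variation nonnegative for all
compactly supported smooth pairs `φ, ψ` on the plane, after rescaling into `Ω`
(`IntegralConvex.integral_secondVar_nonneg_univ`). Two explicit pairs give the bounds on `k`.

Lower bound: for `φ = (u, 0)`, `ψ = (0, v)` with `∇u ⟂ ∇v` the integrand is `(2 + k)|∇u|²|∇v|²`. A
radial `u` and an angular `v` meet this condition.

Upper bound: `φ` smooths the map equal to `x` in the unit disc and to `x/|x|²` outside, and `ψ` is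
`φ` with its second component reversed. Where `Dφ` is purely conformal or purely anticonformal the
integrand is a multiple of `8 - 2k`. Both parts are present only in a thin annulus and in a distant
cut-off region, where their total cost is `O(δ)`; hence `k > 4` is impossible. -/

/-! ### Algebra of `g` and its second variation; pointwise convexity. -/

/-- `cof ξ : η`, the polar form of the determinant. -/
noncomputable def detPolar (ξ η : Mat 2 2) : ℝ :=
  ξ 1 1 * η 0 0 + ξ 0 0 * η 1 1 - ξ 0 1 * η 1 0 - ξ 1 0 * η 0 1

/-- Half the second derivative of `t ↦ g k (ξ + t • η)` at `0`. -/
noncomputable def secondVar (k : ℝ) (ξ η : Mat 2 2) : ℝ :=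
  2 * frobInner ξ ξ * frobInner η η + 4 * frobInner ξ η ^ 2 +
    k * (detPolar ξ η ^ 2 + 2 * ξ.det * η.det)

theorem frobInner_eq (ξ η : Mat 2 2) :
    frobInner ξ η = ξ 0 0 * η 0 0 + ξ 0 1 * η 0 1 + ξ 1 0 * η 1 0 + ξ 1 1 * η 1 1 := by
  simp [frobInner, Matrix.trace, Matrix.mul_apply, Fin.sum_univ_two]; ring

theorem frobInner_self_nonneg (ξ : Mat 2 2) : 0 ≤ frobInner ξ ξ := by
  rw [frobInner_eq]
  nlinarith [sq_nonneg (ξ 0 0), sq_nonneg (ξ 0 1), sq_nonneg (ξ 1 0), sq_nonneg (ξ 1 1)]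

theorem frobNorm_sq (ξ : Mat 2 2) : frobNorm ξ ^ 2 = frobInner ξ ξ :=
  Real.sq_sqrt (frobInner_self_nonneg ξ)

theorem frobNorm_pow_four (ξ : Mat 2 2) : frobNorm ξ ^ 4 = frobInner ξ ξ * frobInner ξ ξ := by
  rw [← frobNorm_sq]; ring

theorem g_eq (k : ℝ) (ξ : Mat 2 2) :
    g k ξ = frobInner ξ ξ * frobInner ξ ξ + k * (ξ.det * ξ.det) := by
  rw [g, frobNorm_pow_four]; ring

theorem g_add_smul (k t : ℝ) (ξ η : Mat 2 2) :
    g k (ξ + t • η) =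
      (frobInner ξ ξ + 2 * t * frobInner ξ η + t ^ 2 * frobInner η η) ^ 2 +
        k * (ξ.det + t * detPolar ξ η + t ^ 2 * η.det) ^ 2 := by
  simp only [g_eq, frobInner_eq, Matrix.det_fin_two, detPolar, Matrix.add_apply, Matrix.smul_apply,
    smul_eq_mul]
  ring

theorem hasDerivAt_g_add_smul (k t : ℝ) (ξ η : Mat 2 2) :
    HasDerivAt (fun t : ℝ => g k (ξ + t • η))
      (2 * (frobInner ξ ξ + 2 * t * frobInner ξ η + t ^ 2 * frobInner η η) *
          (2 * frobInner ξ η + 2 * t * frobInner η η) +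
        k * (2 * (ξ.det + t * detPolar ξ η + t ^ 2 * η.det) *
          (detPolar ξ η + 2 * t * η.det))) t := by
  simp only [g_add_smul]
  have h1 : ∀ A B C : ℝ, HasDerivAt (fun t : ℝ => (A + t * B + t ^ 2 * C) ^ 2)
      (2 * (A + t * B + t ^ 2 * C) * (B + 2 * t * C)) t := by
    intro A B C
    have := (((hasDerivAt_id t).mul_const B).const_add A).add
      (((hasDerivAt_id t).pow 2).mul_const C) |>.pow 2
    refine this.congr_deriv ?_
    simp
  have := (h1 (frobInner ξ ξ) (2 * frobInner ξ η) (frobInner η η)).add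
    ((h1 ξ.det (detPolar ξ η) η.det).const_mul k)
  refine (this.congr_deriv ?_).congr_of_eventuallyEq (Eventually.of_forall fun s => ?_)
  · ring
  · simp only [Pi.add_apply]; ring

theorem lineDeriv_g (k : ℝ) (ξ η : Mat 2 2) :
    lineDeriv ℝ (g k) ξ η =
      4 * frobInner ξ ξ * frobInner ξ η + 2 * k * ξ.det * detPolar ξ η := by
  rw [lineDeriv, (hasDerivAt_g_add_smul k 0 ξ η).deriv]; ring

theorem frobInner_matGrad_g (k : ℝ) (ξ η : Mat 2 2) :
    frobInner (matGrad (g k) ξ) η =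
      4 * (frobInner ξ ξ * frobInner ξ η) + 2 * k * (ξ.det * detPolar ξ η) := by
  rw [frobInner_eq]
  simp only [matGrad, Matrix.of_apply, lineDeriv_g]
  simp [frobInner_eq ξ (Matrix.single _ _ _), frobInner_eq ξ η, detPolar]
  ring

theorem frobInner_sq_le (ξ η : Mat 2 2) :
    frobInner ξ η ^ 2 ≤ frobInner ξ ξ * frobInner η η := by
  simp only [frobInner_eq]
  nlinarith [sq_nonneg (ξ 0 0 * η 0 1 - ξ 0 1 * η 0 0), sq_nonneg (ξ 0 0 * η 1 0 - ξ 1 0 * η 0 0),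
    sq_nonneg (ξ 0 0 * η 1 1 - ξ 1 1 * η 0 0), sq_nonneg (ξ 0 1 * η 1 0 - ξ 1 0 * η 0 1),
    sq_nonneg (ξ 0 1 * η 1 1 - ξ 1 1 * η 0 1), sq_nonneg (ξ 1 0 * η 1 1 - ξ 1 1 * η 1 0)]

theorem two_mul_abs_det_le (ξ : Mat 2 2) : 2 * |ξ.det| ≤ frobInner ξ ξ := by
  have h : |2 * ξ.det| ≤ frobInner ξ ξ := by
    rw [abs_le, frobInner_eq, Matrix.det_fin_two]
    constructor <;>
    nlinarith [sq_nonneg (ξ 0 0 - ξ 1 1), sq_nonneg (ξ 0 1 + ξ 1 0), sq_nonneg (ξ 0 0 + ξ 1 1),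
      sq_nonneg (ξ 0 1 - ξ 1 0)]
  rwa [abs_mul, abs_two] at h

/-- Modulo the null Lagrangians `η ↦ ξ : η`, `cof ξ : η`, `det η`, the quasimonotonicity integrand
is bounded below by a multiple of `|η|⁴`. -/
theorem le_frobInner_matGrad_g {k : ℝ} (hk : 0 ≤ k) (ξ η : Mat 2 2) :
    (8 - k) / 8 * frobNorm η ^ 4 + 4 * frobInner ξ ξ * frobInner ξ η +
        2 * k * ξ.det * detPolar ξ η + 4 * k * ξ.det * η.det ≤
      frobInner (matGrad (g k) (ξ + η)) η := by
  have h1 : frobInner (ξ + η) (ξ + η) =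
      frobInner ξ ξ + 2 * frobInner ξ η + frobInner η η := by
    simp only [frobInner_eq, Matrix.add_apply]; ring
  have h2 : frobInner (ξ + η) η = frobInner ξ η + frobInner η η := by
    simp only [frobInner_eq, Matrix.add_apply]; ring
  have h3 : (ξ + η).det = ξ.det + detPolar ξ η + η.det := by
    simp only [Matrix.det_fin_two, detPolar, Matrix.add_apply]; ring
  have h4 : detPolar (ξ + η) η = detPolar ξ η + 2 * η.det := by
    simp only [Matrix.det_fin_two, detPolar, Matrix.add_apply]; ring
  rw [frobInner_matGrad_g, h1, h2, h3, h4, frobNorm_pow_four]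
  have h5 := frobInner_sq_le ξ η
  have h6 : 4 * η.det ^ 2 ≤ frobInner η η ^ 2 := by
    have := two_mul_abs_det_le η
    nlinarith [abs_nonneg η.det, sq_abs η.det]
  generalize frobInner ξ ξ = X at *
  generalize frobInner η η = n at *
  generalize frobInner ξ η = s at *
  generalize detPolar ξ η = a at *
  generalize η.det = d at *
  generalize ξ.det = D at *
  -- By `s² ≤ X n` the norm terms are at least `12 (s + n/2)² + n²`. The determinant terms are `2k
  -- ((a + 3d/2)² - d²/4)`, and `4d² ≤ n²` bounds them below by `-k n²/8`.
  nlinarith [sq_nonneg (s + n / 2), mul_nonneg hk (sq_nonneg (a + 3 * d / 2)),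
    mul_nonneg hk (sub_nonneg.2 h6)]

theorem secondVar_nonneg {k : ℝ} (h1 : -2 ≤ k) (h2 : k ≤ 4) (ξ η : Mat 2 2) :
    0 ≤ secondVar k ξ η := by
  have hp : 0 ≤ secondVar 4 ξ η := by
    have hξ := two_mul_abs_det_le ξ
    have hη := two_mul_abs_det_le η
    have h : |ξ.det * η.det| * 4 ≤ frobInner ξ ξ * frobInner η η := by
      rw [abs_mul]
      nlinarith [mul_le_mul hξ hη (by positivity) (by linarith [abs_nonneg ξ.det])]
    rw [secondVar]
    nlinarith [neg_abs_le (ξ.det * η.det), sq_nonneg (frobInner ξ η), sq_nonneg (detPolar ξ η)]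
  have hm : 0 ≤ secondVar (-2) ξ η := by
    simp only [secondVar, frobInner_eq, detPolar, Matrix.det_fin_two]
    -- The squares use coordinates that split a matrix into its conformal part `(x + w, z - y)` and
    -- its anticonformal part `(x - w, z + y)`.
    generalize ξ 0 0 = x, ξ 0 1 = y, ξ 1 0 = z, ξ 1 1 = w
    generalize η 0 0 = x', η 0 1 = y', η 1 0 = z', η 1 1 = w'
    linarith [sq_nonneg ((x + w) * (z' - y') - (z - y) * (x' + w')),
      sq_nonneg ((x - w) * (z' + y') - (z + y) * (x' - w')),
      sq_nonneg (x * x' + y * y' + z * z' + w * w'),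
      sq_nonneg ((x + w) * (x' - w') + (x - w) * (x' + w')),
      sq_nonneg ((x + w) * (z' + y') + (z + y) * (x' + w')),
      sq_nonneg ((z - y) * (x' - w') + (x - w) * (z' - y')),
      sq_nonneg ((z - y) * (z' + y') + (z + y) * (z' - y'))]
  have : secondVar k ξ η =
      (4 - k) / 6 * secondVar (-2) ξ η + (k + 2) / 6 * secondVar 4 ξ η := by
    simp only [secondVar]; ring
  rw [this]
  exact add_nonneg (mul_nonneg (by linarith) hm) (mul_nonneg (by linarith) hp)

theorem convexOn_quartic {c₀ c₁ c₂ c₃ c₄ : ℝ}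
    (h : ∀ t : ℝ, 0 ≤ 2 * c₂ + 6 * c₃ * t + 12 * c₄ * t ^ 2) :
    ConvexOn ℝ Set.univ (fun t : ℝ => c₀ + c₁ * t + c₂ * t ^ 2 + c₃ * t ^ 3 + c₄ * t ^ 4) := by
  have h1 : ∀ t : ℝ, HasDerivAt (fun t : ℝ => c₀ + c₁ * t + c₂ * t ^ 2 + c₃ * t ^ 3 + c₄ * t ^ 4)
      (c₁ + 2 * c₂ * t + 3 * c₃ * t ^ 2 + 4 * c₄ * t ^ 3) t := fun t => by
    refine (((((hasDerivAt_id t).const_mul c₁).const_add c₀).add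
      ((hasDerivAt_pow 2 t).const_mul c₂)).add ((hasDerivAt_pow 3 t).const_mul c₃)).add
      ((hasDerivAt_pow 4 t).const_mul c₄) |>.congr_deriv ?_
    simp; ring
  have h2 : ∀ t : ℝ, HasDerivAt (fun t : ℝ => c₁ + 2 * c₂ * t + 3 * c₃ * t ^ 2 + 4 * c₄ * t ^ 3)
      (2 * c₂ + 6 * c₃ * t + 12 * c₄ * t ^ 2) t := fun t => by
    refine ((((hasDerivAt_id t).const_mul (2 * c₂)).const_add c₁).add
      ((hasDerivAt_pow 2 t).const_mul (3 * c₃))).add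
      ((hasDerivAt_pow 3 t).const_mul (4 * c₄)) |>.congr_deriv ?_
    simp; ring
  refine MonotoneOn.convexOn_of_deriv convex_univ
    (fun t _ => (h1 t).continuousAt.continuousWithinAt)
    (fun t _ => (h1 t).differentiableAt.differentiableWithinAt) ?_
  rw [funext fun t => (h1 t).deriv]
  exact (monotone_of_deriv_nonneg (fun t => (h2 t).differentiableAt)
    fun t => by rw [(h2 t).deriv]; exact h t).monotoneOn _

/-- On each line `g` is a quartic polynomial in `t`, whose second derivative is twice `secondVar` at
the moving point. -/
theorem convexOn_g {k : ℝ} (h1 : -2 ≤ k) (h2 : k ≤ 4) : ConvexOn ℝ Set.univ (g k) := by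
  refine ⟨convex_univ, fun ξ _ ζ _ a b ha hb hab => ?_⟩
  set η := ζ - ξ with hη
  have hc : ConvexOn ℝ Set.univ (fun t : ℝ => g k (ξ + t • η)) := by
    have he : ∀ t : ℝ, g k (ξ + t • η) = g k ξ +
        (4 * frobInner ξ ξ * frobInner ξ η + 2 * k * ξ.det * detPolar ξ η) * t +
        secondVar k ξ η * t ^ 2 + (4 * frobInner ξ η * frobInner η η +
          2 * k * detPolar ξ η * η.det) * t ^ 3 + g k η * t ^ 4 := fun t => by
      rw [g_add_smul, g_eq, g_eq, secondVar]; ring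
    simp only [he]
    refine convexOn_quartic fun t => (mul_nonneg zero_le_two
      (secondVar_nonneg h1 h2 (ξ + t • η) η)).trans_eq ?_
    simp only [secondVar, g_eq, frobInner_eq, detPolar, Matrix.det_fin_two, Matrix.add_apply,
      Matrix.smul_apply, smul_eq_mul]
    ring
  have := hc.2 (Set.mem_univ 0) (Set.mem_univ 1) ha hb hab
  simp only [smul_eq_mul, mul_zero, zero_add, mul_one, zero_smul, add_zero, one_smul] at this ⊢
  have e1 : ξ + η = ζ := by rw [hη]; abel
  have e2 : a • ξ + b • ζ = ξ + b • η := by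
    rw [hη, eq_sub_iff_add_eq.2 hab]; module
  rw [e2]; rwa [e1] at this

/-! ### Test functions and weak gradients. -/

section WeakGradient

variable {n N : ℕ} {Ω : Set (E n)}

theorem isWeakGrad_weakGrad {u : E n → E N} (h : ∃ U, IsWeakGrad Ω u U) :
    IsWeakGrad Ω u (weakGrad Ω u) := by
  rw [weakGrad, dif_pos h]; exact h.choose_spec

theorem IsTest.integrable {F : Type*} [NormedAddCommGroup F] [NormedSpace ℝ F] {φ : E n → F}
    (h : IsTest Ω φ) : Integrable φ :=
  h.smooth.continuous.integrable_of_hasCompactSupport h.compactSupport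

theorem IsTest.mono {F : Type*} [NormedAddCommGroup F] [NormedSpace ℝ F] {φ : E n → F}
    {Ω' : Set (E n)} (h : IsTest Ω φ) (hs : Ω ⊆ Ω') : IsTest Ω' φ :=
  ⟨h.smooth, h.compactSupport, h.support_subset.trans hs⟩

theorem IsTest.eq_zero {F : Type*} [NormedAddCommGroup F] [NormedSpace ℝ F] {φ : E n → F}
    (h : IsTest Ω φ) {x : E n} (hx : x ∉ Ω) : φ x = 0 :=
  image_eq_zero_of_notMem_tsupport fun h' => hx (h.support_subset h')

theorem IsTest.comp_linear {F F' : Type*} [NormedAddCommGroup F] [NormedSpace ℝ F]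
    [NormedAddCommGroup F'] [NormedSpace ℝ F'] {φ : E n → F} (h : IsTest Ω φ) (L : F →L[ℝ] F') :
    IsTest Ω (fun x => L (φ x)) :=
  ⟨L.contDiff.comp h.smooth, h.compactSupport.comp_left (g := L) L.map_zero,
    (closure_mono (Function.support_comp_subset L.map_zero φ)).trans h.support_subset⟩

theorem IsTest.apply {φ : E n → E N} (h : IsTest Ω φ) (i : Fin N) :
    IsTest Ω (fun x => φ x i) :=
  h.comp_linear (EuclideanSpace.proj i : E N →L[ℝ] ℝ)

theorem IsTest.smul {F : Type*} [NormedAddCommGroup F] [NormedSpace ℝ F] {φ : E n → F}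
    (h : IsTest Ω φ) (a : ℝ) : IsTest Ω (fun x => a • φ x) :=
  h.comp_linear (a • ContinuousLinearMap.id ℝ F)

theorem IsTest.add {F : Type*} [NormedAddCommGroup F] [NormedSpace ℝ F] {φ ψ : E n → F}
    (h : IsTest Ω φ) (h' : IsTest Ω ψ) : IsTest Ω (fun x => φ x + ψ x) :=
  ⟨h.smooth.add h'.smooth, h.compactSupport.add h'.compactSupport,
    (tsupport_add φ ψ).trans (Set.union_subset h.support_subset h'.support_subset)⟩

theorem IsTest.fderiv_apply {F : Type*} [NormedAddCommGroup F] [NormedSpace ℝ F] {φ : E n → F}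
    (h : IsTest Ω φ) (v : E n) : IsTest Ω (fun x => fderiv ℝ φ x v) := by
  refine ⟨(h.smooth.fderiv_right (m := ∞) (by simp)).clm_apply contDiff_const,
    h.compactSupport.fderiv_apply (𝕜 := ℝ) v, ?_⟩
  exact (tsupport_fderiv_apply_subset ℝ v).trans h.support_subset

theorem jacobian_apply {u : E n → E N} {x : E n} (h : DifferentiableAt ℝ u x) (i : Fin N)
    (j : Fin n) :
    jacobian u x i j = fderiv ℝ (fun y => u y i) x (EuclideanSpace.single j 1) := by
  have := ((EuclideanSpace.proj i : E N →L[ℝ] ℝ).hasFDerivAt.comp x h.hasFDerivAt).fderiv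
  simp only [jacobian, Matrix.of_apply]
  change _ = fderiv ℝ ((EuclideanSpace.proj i : E N →L[ℝ] ℝ) ∘ u) x _
  rw [this]; rfl

theorem IsTest.jacobian_eq {φ : E n → E N} (h : IsTest Ω φ) (x : E n) (i : Fin N) (j : Fin n) :
    jacobian φ x i j = fderiv ℝ (fun y => φ y i) x (EuclideanSpace.single j 1) :=
  jacobian_apply (h.smooth.differentiable (by simp) x) i j

theorem IsTest.jacobian_entry {φ : E n → E N} (h : IsTest Ω φ) (i : Fin N) (j : Fin n) :
    IsTest Ω (fun x => jacobian φ x i j) := by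
  simp only [h.jacobian_eq]; exact (h.apply i).fderiv_apply _

theorem IsTest.jacobian_eq_zero {φ : E n → E N} (h : IsTest Ω φ) {x : E n} (hx : x ∉ Ω) :
    jacobian φ x = 0 := by
  ext i j; exact (h.jacobian_entry i j).eq_zero hx

theorem IsTest.jacobian_add_smul {φ ψ : E n → E N} (h : IsTest Ω φ) (h' : IsTest Ω ψ) (a b : ℝ)
    (x : E n) : jacobian (fun x => a • φ x + b • ψ x) x =
      a • jacobian φ x + b • jacobian ψ x := by
  ext i j
  have h1 := h.smooth.differentiable (by simp) x
  have h2 := h'.smooth.differentiable (by simp) x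
  have := ((h1.hasFDerivAt.const_smul a).add (h2.hasFDerivAt.const_smul b)).fderiv
  simp only [jacobian, Matrix.of_apply, Matrix.add_apply, Matrix.smul_apply]
  change fderiv ℝ (a • φ + b • ψ) x _ i = _
  rw [this]
  simp

theorem IsTest.memLp {φ : E n → ℝ} (h : IsTest Ω φ) (p : ℝ≥0∞) :
    MemLp φ p (volume.restrict Ω) :=
  (h.smooth.continuous.memLp_of_hasCompactSupport h.compactSupport).restrict _

/-- Integration by parts, one factor having compact support. -/
theorem IsTest.integral_mul_fderiv {Ω' : Set (E n)} {φ ψ : E n → ℝ} (h : ContDiff ℝ ∞ φ)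
    (h' : IsTest Ω' ψ) (v : E n) :
    ∫ x, φ x * fderiv ℝ ψ x v = -∫ x, fderiv ℝ φ x v * ψ x := by
  have hφ' : Continuous fun x => fderiv ℝ φ x v :=
    ((h.fderiv_right (m := ∞) (by simp)).clm_apply contDiff_const).continuous
  refine integral_mul_fderiv_eq_neg_fderiv_mul_of_integrable ?_ ?_ ?_
    (fun x _ => h.differentiable (by simp) x) (fun x _ => h'.smooth.differentiable (by simp) x)
  · exact (hφ'.mul h'.smooth.continuous).integrable_of_hasCompactSupport
      h'.compactSupport.mul_left
  · exact (h.continuous.mul (h'.fderiv_apply v).smooth.continuous).integrable_of_hasCompactSupport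
      (h'.fderiv_apply v).compactSupport.mul_left
  · exact (h.continuous.mul h'.smooth.continuous).integrable_of_hasCompactSupport
      h'.compactSupport.mul_left

theorem IsTest.isWeakGrad {φ : E n → E N} (h : IsTest Ω φ) :
    IsWeakGrad Ω φ (jacobian φ) := by
  refine ⟨h.integrable.locallyIntegrable.locallyIntegrableOn _,
    fun i j => (h.jacobian_entry i j).integrable.locallyIntegrable.locallyIntegrableOn _,
    fun ψ hψ i j => ?_⟩
  rw [setIntegral_eq_integral_of_forall_compl_eq_zero,
    setIntegral_eq_integral_of_forall_compl_eq_zero,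
    IsTest.integral_mul_fderiv (h.apply i).smooth hψ]
  · simp only [h.jacobian_eq]
  · intro x hx; simp [hψ.eq_zero hx]
  · intro x hx; simp [(hψ.fderiv_apply (EuclideanSpace.single j 1)).eq_zero hx]

theorem IsTest.integral_fderiv_eq_zero {φ : E n → ℝ} (h : IsTest Ω φ) (v : E n) :
    ∫ x, fderiv ℝ φ x v = 0 := by
  simpa using IsTest.integral_mul_fderiv (contDiff_const (c := (1 : ℝ))) h v

theorem IsTest.integral_jacobian_eq_zero {φ : E n → E N} (h : IsTest Ω φ) (i : Fin N)
    (j : Fin n) : ∫ x in Ω, jacobian φ x i j = 0 := by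
  rw [setIntegral_eq_integral_of_forall_compl_eq_zero fun x hx => (h.jacobian_entry i j).eq_zero hx]
  simp only [h.jacobian_eq]
  exact (h.apply i).integral_fderiv_eq_zero _

theorem integrableOn_mul_isTest {w φ : E n → ℝ}
    (hw : LocallyIntegrableOn w Ω) (hφ : IsTest Ω φ) :
    IntegrableOn (fun x => w x * φ x) Ω := by
  have h1 : IntegrableOn (fun x => w x * φ x) (tsupport φ) :=
    (hw.integrableOn_compact_subset hφ.support_subset hφ.compactSupport).mul_continuousOn
      hφ.smooth.continuous.continuousOn hφ.compactSupport
  exact ((integrableOn_iff_integrable_of_support_subset fun x hx =>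
    subset_tsupport φ fun h => hx (by simp [h])).1 h1).integrableOn

/-- The fundamental lemma of the calculus of variations, applied entrywise to `U - V`. -/
theorem ae_eq_of_isWeakGrad (hΩ : IsOpen Ω) {u : E n → E N} {U V : E n → Mat N n}
    (hU : IsWeakGrad Ω u U) (hV : IsWeakGrad Ω u V) : ∀ᵐ x ∂volume.restrict Ω, U x = V x := by
  have key : ∀ i j, ∀ᵐ x ∂volume.restrict Ω, U x i j = V x i j := by
    intro i j
    have := hΩ.ae_eq_zero_of_integral_contDiff_smul_eq_zero
      ((hU.locIntGrad i j).sub (hV.locIntGrad i j)) (fun φ h1 h2 h3 => ?_)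
    · rw [ae_restrict_iff' hΩ.measurableSet]
      filter_upwards [this] with x hx hxΩ
      exact sub_eq_zero.1 (hx hxΩ)
    · have hφ : IsTest Ω φ := ⟨h1, h2, h3⟩
      have e := (hU.integral_eq φ hφ i j).symm.trans (hV.integral_eq φ hφ i j)
      rw [← setIntegral_eq_integral_of_forall_compl_eq_zero (s := Ω)
        fun x hx => by simp [hφ.eq_zero hx]]
      have : ∀ x, φ x • ((fun x => U x i j) - fun x => V x i j) x =
          U x i j * φ x - V x i j * φ x := fun x => by simp; ring
      simp only [this]
      rw [integral_sub (integrableOn_mul_isTest (hU.locIntGrad i j) hφ)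
        (integrableOn_mul_isTest (hV.locIntGrad i j) hφ)]
      linarith
  have := (ae_all_iff.2 fun i => ae_all_iff.2 fun j => key i j)
  filter_upwards [this] with x hx
  ext i j; exact hx i j

/-- `weakGrad` is an arbitrary choice among the weak gradients, so every computation with it goes
through this almost everywhere identification. -/
theorem weakGrad_ae_eq (hΩ : IsOpen Ω) {u : E n → E N} {U : E n → Mat N n}
    (hU : IsWeakGrad Ω u U) : ∀ᵐ x ∂volume.restrict Ω, weakGrad Ω u x = U x :=
  ae_eq_of_isWeakGrad hΩ (isWeakGrad_weakGrad ⟨U, hU⟩) hU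

theorem IsWeakGrad.add_smul {u v : E n → E N} {U V : E n → Mat N n}
    (hU : IsWeakGrad Ω u U) (hV : IsWeakGrad Ω v V) (a b : ℝ) :
    IsWeakGrad Ω (a • u + b • v) (fun x => a • U x + b • V x) := by
  refine ⟨(hU.locInt.smul a).add (hV.locInt.smul b),
    fun i j => ((hU.locIntGrad i j).smul a).add ((hV.locIntGrad i j).smul b), fun φ hφ i j => ?_⟩
  have hloc : ∀ {w : E n → E N}, LocallyIntegrableOn w Ω →
      LocallyIntegrableOn (fun x => w x i) Ω := fun hw x hx =>
    let ⟨s, hs, hi⟩ := hw x hx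
    ⟨s, hs, (EuclideanSpace.proj i : E N →L[ℝ] ℝ).integrable_comp hi⟩
  have hd := hφ.fderiv_apply (EuclideanSpace.single j 1)
  have e1 := hU.integral_eq φ hφ i j
  have e2 := hV.integral_eq φ hφ i j
  have f1 : ∀ x, (a • u + b • v) x i * fderiv ℝ φ x (EuclideanSpace.single j 1) =
      a * (u x i * fderiv ℝ φ x (EuclideanSpace.single j 1)) +
      b * (v x i * fderiv ℝ φ x (EuclideanSpace.single j 1)) := fun x => by simp; ring
  have f2 : ∀ x, (a • U x + b • V x) i j * φ x = a * (U x i j * φ x) + b * (V x i j * φ x) :=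
    fun x => by simp; ring
  simp only [f1, f2]
  rw [integral_add ((integrableOn_mul_isTest (hloc hU.locInt) hd).const_mul a)
      ((integrableOn_mul_isTest (hloc hV.locInt) hd).const_mul b),
    integral_add ((integrableOn_mul_isTest (hU.locIntGrad i j) hφ).const_mul a)
      ((integrableOn_mul_isTest (hV.locIntGrad i j) hφ).const_mul b)]
  simp only [integral_const_mul, e1, e2]
  ring

/-- The constant sequence `φ` is an approximating sequence in every exponent. Smooth fields can
therefore be used to test integral convexity. -/
theorem IsTest.mem_W10 (hΩ : IsOpen Ω) {φ : E n → E N} (h : IsTest Ω φ) (p : ℝ≥0∞) :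
    φ ∈ W10 N Ω p := by
  have hae := weakGrad_ae_eq hΩ h.isWeakGrad
  refine ⟨⟨(h.smooth.continuous.memLp_of_hasCompactSupport h.compactSupport).restrict _,
    ⟨_, h.isWeakGrad⟩, fun i j => ((h.jacobian_entry i j).memLp p).ae_eq ?_⟩, fun _ => φ, fun _ => h,
    by simp, fun i j => ?_⟩
  · filter_upwards [hae] with x hx; rw [hx]
  · refine tendsto_const_nhds.congr fun _ => ?_
    rw [← eLpNorm_zero (p := if p = ⊤ then 1 else p) (μ := volume.restrict Ω) (ε := ℝ)]
    refine (eLpNorm_congr_ae ?_).symm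
    filter_upwards [hae] with x hx; simp [hx]

end WeakGradient

/-! ### The determinant as a null Lagrangian. -/

theorem ContDiff.fderiv_fderiv_comm {n : ℕ} {u : E n → ℝ} (h : ContDiff ℝ ∞ u) (v w x : E n) :
    fderiv ℝ (fun y => fderiv ℝ u y v) x w = fderiv ℝ (fun y => fderiv ℝ u y w) x v := by
  have hs : IsSymmSndFDerivAt ℝ u x :=
    h.contDiffAt.isSymmSndFDerivAt (by
      simp only [minSmoothness_of_isRCLikeNormedField]; exact WithTop.coe_le_coe.2 le_top)
  have hd : DifferentiableAt ℝ (fderiv ℝ u) x :=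
    (h.fderiv_right (m := ∞) (by simp)).differentiable (by simp) x
  have key : ∀ a b : E n, fderiv ℝ (fun y => fderiv ℝ u y a) x b = fderiv ℝ (fderiv ℝ u) x b a := by
    intro a b
    rw [(hd.hasFDerivAt.clm_apply (hasFDerivAt_const a x)).fderiv]
    simp
  rw [key, key, hs]

/-- Integrating each product by parts moves a derivative from the second component onto the first;
the two mixed second derivatives then cancel by symmetry. -/
theorem IsTest.integral_det_jacobian_eq_zero {Ω : Set (E 2)} {φ : E 2 → E 2} (h : IsTest Ω φ) :
    ∫ x in Ω, (jacobian φ x 0 0 * jacobian φ x 1 1 - jacobian φ x 0 1 * jacobian φ x 1 0) = 0 := by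
  rw [setIntegral_eq_integral_of_forall_compl_eq_zero
    fun x hx => by simp [h.jacobian_eq_zero hx]]
  have hi : ∀ i j k l, Integrable fun x => jacobian φ x i j * jacobian φ x k l := fun i j k l =>
    ((h.jacobian_entry i j).smooth.continuous.mul
      (h.jacobian_entry k l).smooth.continuous).integrable_of_hasCompactSupport
      (h.jacobian_entry i j).compactSupport.mul_right
  have hp : ∀ a b : E 2, ∫ x, fderiv ℝ (fun y => φ y 0) x a * fderiv ℝ (fun y => φ y 1) x b =
      -∫ x, fderiv ℝ (fun y => fderiv ℝ (fun y => φ y 0) y a) x b * φ x 1 := fun a b =>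
    IsTest.integral_mul_fderiv ((h.apply 0).fderiv_apply a).smooth (h.apply 1) b
  rw [integral_sub (hi _ _ _ _) (hi _ _ _ _)]
  simp only [h.jacobian_eq]
  rw [hp, hp]
  simp only [ContDiff.fderiv_fderiv_comm (h.apply 0).smooth (EuclideanSpace.single 0 1)]
  ring

/-! ### Integrability of the quartic integrands and limits of products. -/

section Integrability

variable {α : Type*} [MeasurableSpace α] {μ : Measure α}

instance holderTriple_four_four_two : ENNReal.HolderTriple 4 4 2 := ⟨by
  have h4 : (4 : ℝ≥0∞) = 2 * 2 := by norm_num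
  rw [h4, ENNReal.mul_inv (by simp) (by simp), ← mul_add, ENNReal.inv_two_add_inv_two, mul_one]⟩

theorem MemLp.mul_four {f h : α → ℝ} (hf : MemLp f 4 μ) (hh : MemLp h 4 μ) :
    MemLp (fun x => f x * h x) 2 μ :=
  hh.mul' hf

theorem MemLp.frobInner {ξ η : α → Mat 2 2} (hξ : ∀ i j, MemLp (fun x => ξ x i j) 4 μ)
    (hη : ∀ i j, MemLp (fun x => η x i j) 4 μ) : MemLp (fun x => frobInner (ξ x) (η x)) 2 μ := by
  simp only [frobInner_eq]
  exact (((MemLp.mul_four (hξ 0 0) (hη 0 0)).add (MemLp.mul_four (hξ 0 1) (hη 0 1))).add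
    (MemLp.mul_four (hξ 1 0) (hη 1 0))).add (MemLp.mul_four (hξ 1 1) (hη 1 1))

theorem MemLp.det {ξ : α → Mat 2 2} (hξ : ∀ i j, MemLp (fun x => ξ x i j) 4 μ) :
    MemLp (fun x => (ξ x).det) 2 μ := by
  simp only [Matrix.det_fin_two]
  exact (MemLp.mul_four (hξ 0 0) (hξ 1 1)).sub (MemLp.mul_four (hξ 0 1) (hξ 1 0))

theorem MemLp.detPolar {ξ η : α → Mat 2 2} (hξ : ∀ i j, MemLp (fun x => ξ x i j) 4 μ)
    (hη : ∀ i j, MemLp (fun x => η x i j) 4 μ) : MemLp (fun x => detPolar (ξ x) (η x)) 2 μ := by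
  simp only [IntegralConvexity.detPolar]
  exact (((MemLp.mul_four (hξ 1 1) (hη 0 0)).add (MemLp.mul_four (hξ 0 0) (hη 1 1))).sub
    (MemLp.mul_four (hξ 0 1) (hη 1 0))).sub (MemLp.mul_four (hξ 1 0) (hη 0 1))

theorem integrable_frobNorm_pow_four {ξ : α → Mat 2 2}
    (hξ : ∀ i j, MemLp (fun x => ξ x i j) 4 μ) : Integrable (fun x => frobNorm (ξ x) ^ 4) μ := by
  simp only [frobNorm_pow_four]
  exact (MemLp.frobInner hξ hξ).integrable_mul (MemLp.frobInner hξ hξ)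

theorem integrable_g (k : ℝ) {ξ : α → Mat 2 2} (hξ : ∀ i j, MemLp (fun x => ξ x i j) 4 μ) :
    Integrable (fun x => g k (ξ x)) μ := by
  simp only [g_eq]
  exact ((MemLp.frobInner hξ hξ).integrable_mul (MemLp.frobInner hξ hξ)).add
    (((MemLp.det hξ).integrable_mul (MemLp.det hξ)).const_mul k)

theorem integrable_frobInner_matGrad_g (k : ℝ) {ξ η : α → Mat 2 2}
    (hξ : ∀ i j, MemLp (fun x => ξ x i j) 4 μ) (hη : ∀ i j, MemLp (fun x => η x i j) 4 μ) :
    Integrable (fun x => frobInner (matGrad (g k) (ξ x)) (η x)) μ := by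
  simp only [frobInner_matGrad_g]
  exact (((MemLp.frobInner hξ hξ).integrable_mul (MemLp.frobInner hξ hη)).const_mul 4).add
    (((MemLp.det hξ).integrable_mul (MemLp.detPolar hξ hη)).const_mul (2 * k))

theorem integrable_secondVar (k : ℝ) {ξ η : α → Mat 2 2}
    (hξ : ∀ i j, MemLp (fun x => ξ x i j) 4 μ) (hη : ∀ i j, MemLp (fun x => η x i j) 4 μ) :
    Integrable (fun x => secondVar k (ξ x) (η x)) μ := by
  have : ∀ x, secondVar k (ξ x) (η x) = 2 * (frobInner (ξ x) (ξ x) * frobInner (η x) (η x)) +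
      4 * (frobInner (ξ x) (η x) * frobInner (ξ x) (η x)) +
      k * (detPolar (ξ x) (η x) * detPolar (ξ x) (η x) + 2 * ((ξ x).det * (η x).det)) :=
    fun x => by rw [secondVar]; ring
  simp only [this]
  exact ((((MemLp.frobInner hξ hξ).integrable_mul (MemLp.frobInner hη hη)).const_mul 2).add
    (((MemLp.frobInner hξ hη).integrable_mul (MemLp.frobInner hξ hη)).const_mul 4)).add
    ((((MemLp.detPolar hξ hη).integrable_mul (MemLp.detPolar hξ hη)).add
      (((MemLp.det hξ).integrable_mul (MemLp.det hη)).const_mul 2)).const_mul k)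

theorem integral_linearCombination {f₁ f₂ f₃ f₄ : α → ℝ} (h₁ : Integrable f₁ μ)
    (h₂ : Integrable f₂ μ) (h₃ : Integrable f₃ μ) (h₄ : Integrable f₄ μ) (a b c d : ℝ) :
    Integrable (fun x => a * f₁ x + b * f₂ x + c * f₃ x + d * f₄ x) μ ∧
    ∫ x, (a * f₁ x + b * f₂ x + c * f₃ x + d * f₄ x) ∂μ =
      a * ∫ x, f₁ x ∂μ + b * ∫ x, f₂ x ∂μ + c * ∫ x, f₃ x ∂μ + d * ∫ x, f₄ x ∂μ := by
  have h12 : Integrable (fun x => a * f₁ x + b * f₂ x) μ := (h₁.const_mul a).add (h₂.const_mul b)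
  have h123 : Integrable (fun x => a * f₁ x + b * f₂ x + c * f₃ x) μ := h12.add (h₃.const_mul c)
  refine ⟨h123.add (h₄.const_mul d), ?_⟩
  rw [integral_add h123 (h₄.const_mul d), integral_add h12 (h₃.const_mul c),
    integral_add (h₁.const_mul a) (h₂.const_mul b)]
  simp only [integral_const_mul]

/-- Convergence of the integrals of products of sequences converging in `L²`. -/
theorem tendsto_integral_mul {f h : ℕ → α → ℝ} {f₀ h₀ : α → ℝ}
    (hf : ∀ m, MemLp (f m) 2 μ) (hh : ∀ m, MemLp (h m) 2 μ) (hf₀ : MemLp f₀ 2 μ)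
    (hh₀ : MemLp h₀ 2 μ) (hft : Tendsto (fun m => eLpNorm (f m - f₀) 2 μ) atTop (𝓝 0))
    (hht : Tendsto (fun m => eLpNorm (h m - h₀) 2 μ) atTop (𝓝 0)) :
    Tendsto (fun m => ∫ x, f m x * h m x ∂μ) atTop (𝓝 (∫ x, f₀ x * h₀ x ∂μ)) := by
  have h1 := (Lp.tendsto_Lp_iff_tendsto_eLpNorm'' f hf f₀ hf₀).2 hft
  have h2 := (Lp.tendsto_Lp_iff_tendsto_eLpNorm'' h hh h₀ hh₀).2 hht
  have key : ∀ {u v : α → ℝ} (hu : MemLp u 2 μ) (hv : MemLp v 2 μ),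
      inner ℝ (hu.toLp u) (hv.toLp v) = ∫ x, u x * v x ∂μ := by
    intro u v hu hv
    rw [L2.inner_def]
    refine integral_congr_ae ?_
    filter_upwards [hu.coeFn_toLp, hv.coeFn_toLp] with x hx hy
    rw [hx, hy]; simp [mul_comm]
  simpa only [key] using h1.inner (𝕜 := ℝ) h2

end Integrability

/-! ### Quasimonotonicity. -/

section Sobolev

variable {Ω : Set (E 2)}

theorem tendsto_eLpNorm_two_of_four {μ : Measure (E 2)} [IsFiniteMeasure μ] {f : ℕ → E 2 → ℝ}
    (hf : ∀ m, AEStronglyMeasurable (f m) μ)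
    (h : Tendsto (fun m => eLpNorm (f m) 4 μ) atTop (𝓝 0)) :
    Tendsto (fun m => eLpNorm (f m) 2 μ) atTop (𝓝 0) := by
  have hc : μ Set.univ ^ (1 / (2 : ℝ≥0∞).toReal - 1 / (4 : ℝ≥0∞).toReal) ≠ ⊤ :=
    ENNReal.rpow_ne_top_of_nonneg (by norm_num) (measure_ne_top _ _)
  have := ENNReal.Tendsto.mul_const h (Or.inr hc)
  rw [zero_mul] at this
  exact tendsto_of_tendsto_of_tendsto_of_le_of_le tendsto_const_nhds this (fun _ => zero_le)
    fun m => eLpNorm_le_eLpNorm_mul_rpow_measure_univ (by norm_num) (hf m)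

theorem isFiniteMeasure_restrict_of_isBounded (hb : Bornology.IsBounded Ω) :
    IsFiniteMeasure (volume.restrict Ω) :=
  ⟨by simpa using hb.measure_lt_top⟩

/-- The null Lagrangians have zero integral on `W₀^{1,4}`. -/
theorem integral_weakGrad_eq_zero (hb : Bornology.IsBounded Ω) {φ : E 2 → E 2}
    (hφ : φ ∈ W10 2 Ω 4) :
    (∀ i j, ∫ x in Ω, weakGrad Ω φ x i j = 0) ∧ ∫ x in Ω, (weakGrad Ω φ x).det = 0 := by
  have := isFiniteMeasure_restrict_of_isBounded hb
  obtain ⟨⟨-, -, hW⟩, u, hu, -, hlim⟩ := hφ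
  rw [if_neg (by simp)] at hlim
  have hW2 : ∀ i j, MemLp (fun x => weakGrad Ω φ x i j) 2 (volume.restrict Ω) :=
    fun i j => (hW i j).mono_exponent (by norm_num)
  have hJ2 : ∀ m i j, MemLp (fun x => jacobian (u m) x i j) 2 (volume.restrict Ω) :=
    fun m i j => ((hu m).jacobian_entry i j).memLp 2
  -- Since the determinant is quadratic, `L²` convergence of the entries already passes to the
  -- limit; it follows from `L⁴` convergence because `Ω` has finite measure.
  have ht : ∀ i j, Tendsto (fun m => eLpNorm ((fun x => jacobian (u m) x i j) -
      fun x => weakGrad Ω φ x i j) 2 (volume.restrict Ω)) atTop (𝓝 0) := fun i j =>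
    tendsto_eLpNorm_two_of_four
      (fun m => ((hJ2 m i j).sub (hW2 i j)).aestronglyMeasurable) (hlim i j)
  have hmul := fun i j k l => tendsto_integral_mul (fun m => hJ2 m i j) (fun m => hJ2 m k l)
    (hW2 i j) (hW2 k l) (ht i j) (ht k l)
  constructor
  · intro i j
    have h1 : MemLp (fun _ : E 2 => (1 : ℝ)) 2 (volume.restrict Ω) := memLp_const 1
    have := tendsto_integral_mul (fun m => hJ2 m i j) (fun _ => h1) (hW2 i j) h1 (ht i j)
      (by simp)
    simp only [mul_one, (hu _).integral_jacobian_eq_zero] at this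
    exact (tendsto_nhds_unique tendsto_const_nhds this).symm
  · simp only [Matrix.det_fin_two]
    have hsub : ∀ ξ : E 2 → Mat 2 2, (∀ i j, MemLp (fun x => ξ x i j) 2 (volume.restrict Ω)) →
        ∫ x in Ω, (ξ x 0 0 * ξ x 1 1 - ξ x 0 1 * ξ x 1 0) =
          (∫ x in Ω, ξ x 0 0 * ξ x 1 1) - ∫ x in Ω, ξ x 0 1 * ξ x 1 0 := fun ξ hξ =>
      integral_sub ((hξ 0 0).integrable_mul (hξ 1 1)) ((hξ 0 1).integrable_mul (hξ 1 0))
    rw [hsub _ hW2]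
    refine (tendsto_nhds_unique tendsto_const_nhds
      (((hmul 0 0 1 1).sub (hmul 0 1 1 0)).congr fun m => ?_)).symm
    rw [← hsub _ (hJ2 m)]
    exact (hu m).integral_det_jacobian_eq_zero

/-- Only the vanishing integrals of the null Lagrangians are required of `W`, so the estimate serves
both classical Jacobians of test fields on `G` and weak gradients on `W₀^{1,4}`. -/
theorem integral_frobInner_matGrad_g_ge {μ : Measure (E 2)} [IsFiniteMeasure μ] {k : ℝ}
    (hk : 0 ≤ k) (ξ : Mat 2 2) {W : E 2 → Mat 2 2} (hW : ∀ i j, MemLp (fun x => W x i j) 4 μ)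
    (h1 : ∀ i j, ∫ x, W x i j ∂μ = 0) (h2 : ∫ x, (W x).det ∂μ = 0) :
    Integrable (fun x => frobNorm (W x) ^ 4) μ ∧
    Integrable (fun x => frobInner (matGrad (g k) (ξ + W x)) (W x)) μ ∧
    (8 - k) / 8 * ∫ x, frobNorm (W x) ^ 4 ∂μ ≤
      ∫ x, frobInner (matGrad (g k) (ξ + W x)) (W x) ∂μ := by
  have hξ : ∀ i j, MemLp (fun x => (ξ + W x) i j) 4 μ := fun i j =>
    (memLp_const (ξ i j)).add (hW i j)
  have hW1 : ∀ i j, Integrable (fun x => W x i j) μ := fun i j =>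
    (hW i j).integrable (by norm_num)
  have hd : Integrable (fun x => (W x).det) μ := (MemLp.det hW).integrable (by norm_num)
  have hn := integrable_frobNorm_pow_four hW
  have hI := integrable_frobInner_matGrad_g k hξ hW
  refine ⟨hn, hI, ?_⟩
  obtain ⟨hs, hs0⟩ := integral_linearCombination (hW1 0 0) (hW1 0 1) (hW1 1 0) (hW1 1 1)
    (ξ 0 0) (ξ 0 1) (ξ 1 0) (ξ 1 1)
  obtain ⟨ha, ha0⟩ := integral_linearCombination (hW1 0 0) (hW1 1 1) (hW1 1 0) (hW1 0 1)
    (ξ 1 1) (ξ 0 0) (-ξ 0 1) (-ξ 1 0)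
  have hse : ∀ x, frobInner ξ (W x) =
      ξ 0 0 * W x 0 0 + ξ 0 1 * W x 0 1 + ξ 1 0 * W x 1 0 + ξ 1 1 * W x 1 1 :=
    fun x => frobInner_eq ξ (W x)
  have hae : ∀ x, detPolar ξ (W x) =
      ξ 1 1 * W x 0 0 + ξ 0 0 * W x 1 1 + -ξ 0 1 * W x 1 0 + -ξ 1 0 * W x 0 1 :=
    fun x => by rw [detPolar]; ring
  simp only [← hse, ← hae, h1, mul_zero, add_zero] at hs hs0 ha ha0
  obtain ⟨hL, hL0⟩ := integral_linearCombination hn hs ha hd ((8 - k) / 8)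
    (4 * frobInner ξ ξ) (2 * k * ξ.det) (4 * k * ξ.det)
  have := integral_mono hL hI fun x => le_frobInner_matGrad_g hk ξ (W x)
  rw [hL0, hs0, ha0, h2] at this
  simpa using this

theorem quasimonotone_matGrad_g {k : ℝ} (hk : 0 ≤ k) (hk8 : k ≤ 8) :
    Quasimonotone (matGrad (g k)) := by
  intro G _ hGb _ ξ φ hφ
  have := isFiniteMeasure_restrict_of_isBounded hGb
  have h2 : ∫ x in G, (jacobian φ x).det = 0 := by
    simpa only [Matrix.det_fin_two] using hφ.integral_det_jacobian_eq_zero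
  refine le_trans ?_ (integral_frobInner_matGrad_g_ge hk ξ
    (fun i j => (hφ.jacobian_entry i j).memLp 4) hφ.integral_jacobian_eq_zero h2).2.2
  exact mul_nonneg (by linarith) (integral_nonneg fun x => by positivity)

theorem frobInner_matGrad_g_W10 (hb : Bornology.IsBounded Ω) {k : ℝ} (hk : 0 ≤ k) (ξ : Mat 2 2)
    {φ : E 2 → E 2} (hφ : φ ∈ W10 2 Ω 4) :
    IntegrableOn (fun x => frobNorm (weakGrad Ω φ x) ^ 4) Ω ∧
    IntegrableOn (fun x => frobInner (matGrad (g k) (ξ + weakGrad Ω φ x)) (weakGrad Ω φ x)) Ω ∧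
    (8 - k) / 8 * ∫ x in Ω, frobNorm (weakGrad Ω φ x) ^ 4 ≤
      ∫ x in Ω, frobInner (matGrad (g k) (ξ + weakGrad Ω φ x)) (weakGrad Ω φ x) := by
  have := isFiniteMeasure_restrict_of_isBounded hb
  exact integral_frobInner_matGrad_g_ge hk ξ hφ.1.2.2 (integral_weakGrad_eq_zero hb hφ).1
    (integral_weakGrad_eq_zero hb hφ).2

theorem stronglyQuasimonotone_matGrad_g (hb : Bornology.IsBounded Ω) {k : ℝ} (hk : 0 ≤ k)
    (hk8 : k < 8) : StronglyQuasimonotone Ω 4 (matGrad (g k)) := by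
  refine ⟨(8 - k) / 8, by linarith, fun ξ φ hφ => ?_⟩
  have h4 : ENNReal.ofReal 4 = 4 := by simp
  rw [h4] at hφ
  have := (frobInner_matGrad_g_W10 hb hk ξ hφ).2.2
  exact_mod_cast this

end Sobolev

/-! ### Linear structure of `W10`. -/

theorem tendsto_eLpNorm_linearCombination {α F : Type*} [MeasurableSpace α]
    [NormedAddCommGroup F] [NormedSpace ℝ F] {μ : Measure α} {p : ℝ≥0∞} (hp : 1 ≤ p)
    {f h : ℕ → α → F} (hf : ∀ m, AEStronglyMeasurable (f m) μ)
    (hh : ∀ m, AEStronglyMeasurable (h m) μ)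
    (hft : Tendsto (fun m => eLpNorm (f m) p μ) atTop (𝓝 0))
    (hht : Tendsto (fun m => eLpNorm (h m) p μ) atTop (𝓝 0)) (a b : ℝ) :
    Tendsto (fun m => eLpNorm (a • f m + b • h m) p μ) atTop (𝓝 0) := by
  have hlim : Tendsto (fun m => ‖a‖ₑ * eLpNorm (f m) p μ + ‖b‖ₑ * eLpNorm (h m) p μ) atTop
      (𝓝 0) := by
    have := (ENNReal.Tendsto.const_mul hft (Or.inr (enorm_ne_top (x := a)))).add
      (ENNReal.Tendsto.const_mul hht (Or.inr (enorm_ne_top (x := b))))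
    simpa using this
  refine tendsto_of_tendsto_of_tendsto_of_le_of_le tendsto_const_nhds hlim (fun _ => zero_le)
    fun m => (eLpNorm_add_le ((hf m).const_smul a) ((hh m).const_smul b) hp).trans ?_
  rw [eLpNorm_const_smul, eLpNorm_const_smul]

section Space

variable {n N : ℕ} {Ω : Set (E n)}

theorem weakGrad_add_smul (hΩ : IsOpen Ω) {u v : E n → E N} (hu : ∃ U, IsWeakGrad Ω u U)
    (hv : ∃ V, IsWeakGrad Ω v V) (a b : ℝ) :
    ∀ᵐ x ∂volume.restrict Ω,
      weakGrad Ω (a • u + b • v) x = a • weakGrad Ω u x + b • weakGrad Ω v x :=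
  weakGrad_ae_eq hΩ ((isWeakGrad_weakGrad hu).add_smul (isWeakGrad_weakGrad hv) a b)

theorem W1.add_smul_mem (hΩ : IsOpen Ω) {p : ℝ≥0∞} {u v : E n → E N} (hu : u ∈ W1 N Ω p)
    (hv : v ∈ W1 N Ω p) (a b : ℝ) : a • u + b • v ∈ W1 N Ω p := by
  refine ⟨(hu.1.const_smul a).add (hv.1.const_smul b),
    ⟨_, (isWeakGrad_weakGrad hu.2.1).add_smul (isWeakGrad_weakGrad hv.2.1) a b⟩, fun i j => ?_⟩
  refine (((hu.2.2 i j).const_smul a).add ((hv.2.2 i j).const_smul b)).ae_eq ?_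
  filter_upwards [weakGrad_add_smul hΩ hu.2.1 hv.2.1 a b] with x hx
  rw [hx]; rfl

theorem W10.add_smul_mem (hΩ : IsOpen Ω) {p : ℝ≥0∞} (hp : 1 ≤ p) {u v : E n → E N}
    (hu : u ∈ W10 N Ω p) (hv : v ∈ W10 N Ω p) (a b : ℝ) : a • u + b • v ∈ W10 N Ω p := by
  have hq : 1 ≤ if p = ⊤ then 1 else p := by split_ifs <;> simp [hp]
  refine ⟨W1.add_smul_mem hΩ hu.1 hv.1 a b, ?_⟩
  obtain ⟨hu1, φ, hφ, h1, h2⟩ := hu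
  obtain ⟨hv1, ψ, hψ, h1', h2'⟩ := hv
  refine ⟨fun m x => a • φ m x + b • ψ m x, fun m => ((hφ m).smul a).add ((hψ m).smul b), ?_,
    fun i j => ?_⟩
  · refine (tendsto_eLpNorm_linearCombination hq
      (fun m => ((hφ m).smooth.continuous.aestronglyMeasurable).sub hu1.1.aestronglyMeasurable)
      (fun m => ((hψ m).smooth.continuous.aestronglyMeasurable).sub hv1.1.aestronglyMeasurable)
      h1 h1' a b).congr fun m => ?_
    congr 1; ext1 x; simp only [Pi.add_apply, Pi.smul_apply, Pi.sub_apply]; module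
  · refine (tendsto_eLpNorm_linearCombination hq
      (fun m => (((hφ m).jacobian_entry i j).smooth.continuous.aestronglyMeasurable).sub
        (hu1.2.2 i j).aestronglyMeasurable)
      (fun m => (((hψ m).jacobian_entry i j).smooth.continuous.aestronglyMeasurable).sub
        (hv1.2.2 i j).aestronglyMeasurable)
      (h2 i j) (h2' i j) a b).congr fun m => ?_
    refine eLpNorm_congr_ae ?_
    filter_upwards [weakGrad_add_smul hΩ hu1.2.1 hv1.2.1 a b] with x hx
    rw [(hφ m).jacobian_add_smul (hψ m), hx]
    simp only [Pi.add_apply, Pi.smul_apply, Pi.sub_apply, Matrix.add_apply,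
      Matrix.smul_apply, smul_eq_mul]
    ring

theorem convex_W10 (hΩ : IsOpen Ω) {p : ℝ≥0∞} (hp : 1 ≤ p) : Convex ℝ (W10 N Ω p) :=
  fun _ hu _ hv a b _ _ _ => W10.add_smul_mem hΩ hp hu hv a b

end Space

/-! ### Integral convexity and the second variation. -/

section Energy

variable {Ω : Set (E 2)}

theorem integrableOn_g_weakGrad (hb : Bornology.IsBounded Ω) (k : ℝ) {u : E 2 → E 2}
    (hu : u ∈ W10 2 Ω ⊤) : IntegrableOn (fun x => g k (weakGrad Ω u x)) Ω := by
  have := isFiniteMeasure_restrict_of_isBounded hb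
  exact integrable_g k fun i j => (hu.1.2.2 i j).mono_exponent le_top

theorem integralConvex_g (hΩ : IsOpen Ω) (hb : Bornology.IsBounded Ω) {k : ℝ} (h1 : -2 ≤ k)
    (h2 : k ≤ 4) : IntegralConvex Ω (g k) := by
  refine ⟨convex_W10 hΩ le_top, fun u hu v hv a b ha hb' hab => ?_⟩
  have hIu := integrableOn_g_weakGrad hb k hu
  have hIv := integrableOn_g_weakGrad hb k hv
  have hIw := integrableOn_g_weakGrad hb k (W10.add_smul_mem hΩ le_top hu hv a b)
  simp only [energy, smul_eq_mul]
  rw [← integral_const_mul, ← integral_const_mul,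
    ← integral_add (hIu.const_mul a) (hIv.const_mul b)]
  refine integral_mono_ae hIw ((hIu.const_mul a).add (hIv.const_mul b)) ?_
  filter_upwards [weakGrad_add_smul hΩ hu.1.2.1 hv.1.2.1 a b] with x hx
  rw [hx]
  exact (convexOn_g h1 h2).2 (Set.mem_univ _) (Set.mem_univ _) ha hb' hab

theorem IsTest.energy_eq (hΩ : IsOpen Ω) {φ : E 2 → E 2} (h : IsTest Ω φ) (f : Mat 2 2 → ℝ) :
    energy Ω f φ = ∫ x in Ω, f (jacobian φ x) := by
  refine integral_congr_ae ?_
  filter_upwards [weakGrad_ae_eq hΩ h.isWeakGrad] with x hx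
  rw [hx]

theorem g_add_smul_add_g_sub_smul (k t : ℝ) (ξ η : Mat 2 2) :
    g k (ξ + t • η) + g k (ξ - t • η) =
      2 * g k ξ + 2 * t ^ 2 * secondVar k ξ η + 2 * t ^ 4 * g k η := by
  rw [sub_eq_add_neg, ← neg_smul, g_add_smul, g_add_smul, g_eq, g_eq, secondVar]; ring

/-- The second variation of an integral convex functional is nonnegative. -/
theorem IntegralConvex.integral_secondVar_nonneg (hΩ : IsOpen Ω) {k : ℝ}
    (hc : IntegralConvex Ω (g k)) {φ ψ : E 2 → E 2} (hφ : IsTest Ω φ) (hψ : IsTest Ω ψ) :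
    0 ≤ ∫ x in Ω, secondVar k (jacobian φ x) (jacobian ψ x) := by
  have hJφ : ∀ i j, MemLp (fun x => jacobian φ x i j) 4 (volume.restrict Ω) :=
    fun i j => (hφ.jacobian_entry i j).memLp 4
  have hJψ : ∀ i j, MemLp (fun x => jacobian ψ x i j) 4 (volume.restrict Ω) :=
    fun i j => (hψ.jacobian_entry i j).memLp 4
  have hq := integrable_secondVar k hJφ hJψ
  have hgφ := integrable_g k hJφ
  have hgψ := integrable_g k hJψ
  set q := ∫ x in Ω, secondVar k (jacobian φ x) (jacobian ψ x)
  set r := ∫ x in Ω, g k (jacobian ψ x)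
  -- Midpoint convexity between `φ + tψ` and `φ - tψ`; the odd powers of `t` cancel.
  have key : ∀ t : ℝ, 0 ≤ t ^ 2 * q + t ^ 4 * r := by
    intro t
    have hT : ∀ s : ℝ, IsTest Ω (fun x => (1 : ℝ) • φ x + s • ψ x) :=
      fun s => (hφ.smul 1).add (hψ.smul s)
    have hI : ∀ s : ℝ, Integrable (fun x => g k (jacobian (fun x => (1 : ℝ) • φ x + s • ψ x) x))
        (volume.restrict Ω) := fun s =>
      integrable_g k fun i j => ((hT s).jacobian_entry i j).memLp 4
    have h := hc.2 ((hT t).mem_W10 hΩ ⊤) ((hT (-t)).mem_W10 hΩ ⊤)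
      (by norm_num : (0 : ℝ) ≤ 1 / 2) (by norm_num : (0 : ℝ) ≤ 1 / 2) (by norm_num)
    have hmid : ((1 : ℝ) / 2) • (fun x => (1 : ℝ) • φ x + t • ψ x) +
        ((1 : ℝ) / 2) • (fun x => (1 : ℝ) • φ x + (-t) • ψ x) = φ := by
      ext1 x; simp only [Pi.add_apply, Pi.smul_apply]; module
    rw [hmid, hφ.energy_eq hΩ, (hT t).energy_eq hΩ, (hT (-t)).energy_eq hΩ, smul_eq_mul,
      smul_eq_mul, ← mul_add, ← integral_add (hI t) (hI (-t))] at h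
    have e : ∀ x, g k (jacobian (fun x => (1 : ℝ) • φ x + t • ψ x) x) +
        g k (jacobian (fun x => (1 : ℝ) • φ x + (-t) • ψ x) x) =
        2 * g k (jacobian φ x) + 2 * t ^ 2 * secondVar k (jacobian φ x) (jacobian ψ x) +
        -- The zero term only fills the fourth slot of `integral_linearCombination`.
        2 * t ^ 4 * g k (jacobian ψ x) + 0 * g k (jacobian φ x) := fun x => by
      rw [hφ.jacobian_add_smul hψ, hφ.jacobian_add_smul hψ, one_smul, neg_smul, ← sub_eq_add_neg,
        g_add_smul_add_g_sub_smul]; ring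
    simp only [e] at h
    rw [(integral_linearCombination hgφ hq hgψ hgφ _ _ _ _).2] at h
    linarith
  by_contra! hneg
  have hr : 0 < r := by have := key 1; linarith
  -- This value of `t²` minimises `t² q + t⁴ r`; the minimum `-q²/(4r)` is negative.
  have ht := key (Real.sqrt (-q / (2 * r)))
  have hs : Real.sqrt (-q / (2 * r)) ^ 2 = -q / (2 * r) :=
    Real.sq_sqrt (div_nonneg (by linarith) (by linarith))
  rw [show ∀ t : ℝ, t ^ 4 = (t ^ 2) ^ 2 from fun t => by ring, hs] at ht
  have : -q / (2 * r) * q + (-q / (2 * r)) ^ 2 * r = -(q ^ 2 / (4 * r)) := by field_simp; ring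
  rw [this] at ht
  have : 0 < q ^ 2 / (4 * r) := div_pos (by nlinarith) (by linarith)
  linarith

theorem IsTest.rescale {F : Type*} [NormedAddCommGroup F] [NormedSpace ℝ F] {φ : E 2 → F}
    {R ε : ℝ} (x₀ : E 2) (hε : 0 < ε) (h : IsTest (Metric.ball 0 R) φ) :
    IsTest (Metric.ball x₀ (ε * R)) (fun x => φ (ε⁻¹ • (x - x₀))) := by
  let e : E 2 ≃ₜ E 2 := (Homeomorph.subRight x₀).trans (Homeomorph.smulOfNeZero ε⁻¹ (by positivity))
  refine ⟨h.smooth.comp ((contDiff_id.sub contDiff_const).const_smul ε⁻¹),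
    h.compactSupport.comp_homeomorph e, ?_⟩
  change tsupport (φ ∘ e) ⊆ _
  rw [tsupport_comp_eq_preimage]
  intro x hx
  have : e x ∈ Metric.ball 0 R := h.support_subset hx
  rw [mem_ball_zero_iff] at this
  change ‖ε⁻¹ • (x - x₀)‖ < R at this
  rw [norm_smul, Real.norm_of_nonneg (by positivity), inv_mul_lt_iff₀ hε] at this
  rwa [mem_ball_iff_norm]

theorem jacobian_rescale {φ : E 2 → E 2} (h : Differentiable ℝ φ) {ε : ℝ} (hε : ε ≠ 0)
    (x₀ x : E 2) :
    jacobian (fun x => ε • φ (ε⁻¹ • (x - x₀))) x = jacobian φ (ε⁻¹ • (x - x₀)) := by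
  have h1 : HasFDerivAt (fun x : E 2 => ε⁻¹ • (x - x₀)) (ε⁻¹ • ContinuousLinearMap.id ℝ (E 2)) x :=
    ((hasFDerivAt_id x).sub_const x₀).const_smul ε⁻¹
  have h2 := (((h (ε⁻¹ • (x - x₀))).hasFDerivAt.comp x h1).const_smul ε).fderiv
  ext i j
  simp only [jacobian, Matrix.of_apply]
  change fderiv ℝ (ε • (φ ∘ fun x => ε⁻¹ • (x - x₀))) x _ i = _
  rw [h2]
  simp [hε]

/-- Rescaling to any domain: the second variation of compactly supported maps on the whole plane
is nonnegative as well. -/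
theorem IntegralConvex.integral_secondVar_nonneg_univ (hΩ : IsOpen Ω) (hne : Ω.Nonempty) {k : ℝ}
    (hc : IntegralConvex Ω (g k)) {φ ψ : E 2 → E 2} (hφ : IsTest Set.univ φ)
    (hψ : IsTest Set.univ ψ) :
    0 ≤ ∫ x, secondVar k (jacobian φ x) (jacobian ψ x) := by
  obtain ⟨x₀, hx₀⟩ := hne
  obtain ⟨r, hr, hrΩ⟩ := Metric.isOpen_iff.1 hΩ x₀ hx₀
  obtain ⟨R, hR, hsub⟩ := (hφ.compactSupport.union hψ.compactSupport).isBounded.subset_ball_lt 0 0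
  -- The scaling `ε χ((x - x₀)/ε)` keeps the values of the Jacobian and shrinks the support into
  -- `Ω`. The integral is only multiplied by a positive factor, since `secondVar` vanishes where
  -- both Jacobians do.
  have hε : 0 < r / R := by positivity
  have hmul : r / R * R = r := by field_simp
  have hT : ∀ {χ : E 2 → E 2}, IsTest Set.univ χ → tsupport χ ⊆ Metric.ball 0 R →
      IsTest Ω (fun x => (r / R) • χ ((r / R)⁻¹ • (x - x₀))) := fun h hs =>
    ((IsTest.rescale x₀ hε ⟨h.smooth, h.compactSupport, hs⟩).smul (r / R)).mono
      (by rwa [hmul])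
  have h1 := hT hφ (Set.subset_union_left.trans hsub)
  have h2 := hT hψ (Set.subset_union_right.trans hsub)
  have h := hc.integral_secondVar_nonneg hΩ h1 h2
  rw [setIntegral_eq_integral_of_forall_compl_eq_zero fun x hx => by
    rw [h1.jacobian_eq_zero hx, h2.jacobian_eq_zero hx]
    simp [secondVar, frobInner_eq, detPolar]] at h
  simp only [jacobian_rescale (hφ.smooth.differentiable (by simp)) hε.ne',
    jacobian_rescale (hψ.smooth.differentiable (by simp)) hε.ne'] at h
  rw [integral_sub_right_eq_self (fun x => secondVar k (jacobian φ ((r / R)⁻¹ • x))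
    (jacobian ψ ((r / R)⁻¹ • x))) x₀, Measure.integral_comp_inv_smul volume
    (fun x => secondVar k (jacobian φ x) (jacobian ψ x)), smul_eq_mul] at h
  exact nonneg_of_mul_nonneg_right h (by positivity)

end Energy

/-! ### The radial profile. -/

section Profile

theorem deriv_smoothTransition_eq_zero {x : ℝ} (h : x < 0 ∨ 1 < x) :
    deriv Real.smoothTransition x = 0 := by
  rcases h with h | h
  · have : Real.smoothTransition =ᶠ[𝓝 x] fun _ => 0 := by
      filter_upwards [Iio_mem_nhds h] with y hy
      exact Real.smoothTransition.zero_of_nonpos (le_of_lt hy)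
    rw [this.deriv_eq, deriv_const]
  · have : Real.smoothTransition =ᶠ[𝓝 x] fun _ => 1 := by
      filter_upwards [Ioi_mem_nhds h] with y hy
      exact Real.smoothTransition.one_of_one_le (le_of_lt hy)
    rw [this.deriv_eq, deriv_const]

theorem exists_abs_deriv_smoothTransition_le :
    ∃ C : ℝ, 0 ≤ C ∧ ∀ x, |deriv Real.smoothTransition x| ≤ C := by
  have hc : Continuous (deriv Real.smoothTransition) :=
    (Real.smoothTransition.contDiff (n := 1)).continuous_deriv le_rfl
  obtain ⟨C, hC⟩ := isCompact_Icc (a := (0 : ℝ)) (b := 1) |>.exists_bound_of_continuousOn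
    hc.continuousOn
  refine ⟨C, (norm_nonneg _).trans (hC 0 (by simp)), fun x => ?_⟩
  by_cases hx : x ∈ Set.Icc (0 : ℝ) 1
  · exact hC x hx
  · rw [deriv_smoothTransition_eq_zero, abs_zero]
    · exact (norm_nonneg _).trans (hC 0 (by simp))
    · by_contra! h; exact hx h

theorem hasDerivAt_smoothTransition (x : ℝ) :
    HasDerivAt Real.smoothTransition (deriv Real.smoothTransition x) x :=
  ((Real.smoothTransition.contDiff (n := 1)).differentiable (by simp) x).hasDerivAt

/-- A smooth version of `t ↦ min 1 (1 / t)`, cut off at `t ≈ 1 / δ`. -/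
noncomputable def profile (δ t : ℝ) : ℝ :=
  (1 - Real.smoothTransition ((t - 1) / δ)) +
    Real.smoothTransition ((t - 1) / δ) * (1 - Real.smoothTransition (δ * t - 1)) / t

variable {δ t : ℝ}

theorem profile_of_le_one (hδ : 0 < δ) (ht : t ≤ 1) : profile δ t = 1 := by
  rw [profile, Real.smoothTransition.zero_of_nonpos (div_nonpos_of_nonpos_of_nonneg
    (by linarith) hδ.le)]
  simp

theorem contDiff_profile (hδ : 0 < δ) : ContDiff ℝ ∞ (profile δ) := by
  refine contDiff_iff_contDiffAt.2 fun t => ?_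
  rcases lt_or_ge t 1 with ht | ht
  · refine (contDiffAt_const (c := (1 : ℝ))).congr_of_eventuallyEq ?_
    filter_upwards [Iio_mem_nhds ht] with s hs
    exact profile_of_le_one hδ (le_of_lt hs)
  · have hp : ContDiff ℝ ∞ Real.smoothTransition := Real.smoothTransition.contDiff
    have h1 : ContDiff ℝ ∞ fun t : ℝ => Real.smoothTransition ((t - 1) / δ) :=
      hp.comp ((contDiff_id.sub contDiff_const).div_const δ)
    have h2 : ContDiff ℝ ∞ fun t : ℝ => Real.smoothTransition (δ * t - 1) :=
      hp.comp ((contDiff_const.mul contDiff_id).sub contDiff_const)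
    exact (contDiffAt_const.sub h1.contDiffAt).add
      ((h1.contDiffAt.mul (contDiffAt_const.sub h2.contDiffAt)).div contDiffAt_id (by
        simp; linarith))

theorem mul_profile (ht : t ≠ 0) : t * profile δ t =
    t * (1 - Real.smoothTransition ((t - 1) / δ)) +
      Real.smoothTransition ((t - 1) / δ) * (1 - Real.smoothTransition (δ * t - 1)) := by
  rw [profile]; field_simp

theorem profile_of_ge (hδ : 0 < δ) (hδ2 : δ ≤ 1 / 2) (ht : 2 / δ ≤ t) : profile δ t = 0 := by
  have h1 : 2 ≤ δ * t := by rwa [div_le_iff₀' hδ] at ht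
  have h2 : 1 ≤ (t - 1) / δ := by rw [le_div_iff₀ hδ]; nlinarith
  rw [profile, Real.smoothTransition.one_of_one_le h2,
    Real.smoothTransition.one_of_one_le (by linarith : 1 ≤ δ * t - 1)]
  simp

theorem profile_nonneg (ht : 1 ≤ t) : 0 ≤ profile δ t :=
  add_nonneg (sub_nonneg.2 (Real.smoothTransition.le_one _)) (div_nonneg
    (mul_nonneg (Real.smoothTransition.nonneg _) (sub_nonneg.2 (Real.smoothTransition.le_one _)))
    (by linarith))

theorem profile_le_one (ht : 1 ≤ t) : profile δ t ≤ 1 := by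
  have h := mul_profile (δ := δ) (by linarith : t ≠ 0)
  have h1 := Real.smoothTransition.nonneg ((t - 1) / δ)
  have h2 := Real.smoothTransition.nonneg (δ * t - 1)
  have : t * profile δ t ≤ t * 1 := by
    rw [h]; nlinarith [mul_nonneg h1 h2, mul_nonneg h1 (sub_nonneg.2 ht)]
  exact le_of_mul_le_mul_left this (by linarith)

theorem profile_of_ge_one_add (hδ : 0 < δ) (ht : 1 + δ ≤ t) :
    profile δ t = (1 - Real.smoothTransition (δ * t - 1)) / t := by
  rw [profile, Real.smoothTransition.one_of_one_le (by rw [le_div_iff₀ hδ]; linarith)]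
  simp

/-- The left side is the derivative of `t f(t)`, and `mul_profile` expresses that product without a
quotient. -/
theorem profile_add_mul_deriv (hδ : 0 < δ) (ht : 1 ≤ t) :
    profile δ t + t * deriv (profile δ) t =
      (1 - Real.smoothTransition ((t - 1) / δ)) -
        (t - (1 - Real.smoothTransition (δ * t - 1))) / δ *
          deriv Real.smoothTransition ((t - 1) / δ) -
        δ * Real.smoothTransition ((t - 1) / δ) * deriv Real.smoothTransition (δ * t - 1) := by
  have hd := ((contDiff_profile hδ).differentiable (by simp) t).hasDerivAt
  have h1 : HasDerivAt (fun s => s * profile δ s) (profile δ t + t * deriv (profile δ) t) t :=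
    ((hasDerivAt_id t).mul hd).congr_deriv (by simp)
  have hp1 : HasDerivAt (fun s => Real.smoothTransition ((s - 1) / δ))
      (deriv Real.smoothTransition ((t - 1) / δ) * (1 / δ)) t :=
    (hasDerivAt_smoothTransition _).comp t (((hasDerivAt_id t).sub_const 1).div_const δ)
  have hp2 : HasDerivAt (fun s => Real.smoothTransition (δ * s - 1))
      (deriv Real.smoothTransition (δ * t - 1) * (δ * 1)) t :=
    (hasDerivAt_smoothTransition _).comp t (((hasDerivAt_id t).const_mul δ).sub_const 1)
  have h2 : HasDerivAt (fun s => s * (1 - Real.smoothTransition ((s - 1) / δ)) +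
      Real.smoothTransition ((s - 1) / δ) * (1 - Real.smoothTransition (δ * s - 1))) _ t :=
    ((hasDerivAt_id t).mul (hp1.const_sub 1)).add (hp1.mul (hp2.const_sub 1))
  have he : (fun s => s * profile δ s) =ᶠ[𝓝 t] fun s =>
      s * (1 - Real.smoothTransition ((s - 1) / δ)) +
        Real.smoothTransition ((s - 1) / δ) * (1 - Real.smoothTransition (δ * s - 1)) := by
    filter_upwards [isOpen_ne.mem_nhds (by linarith : t ≠ 0)] with s hs
    exact mul_profile hs
  rw [h1.unique (h2.congr_of_eventuallyEq he)]
  simp only [id]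
  ring

/-- On these ranges `t f(t)` is locally constant, equal to `1` before the cut-off and to `0` after
it. -/
theorem profile_add_mul_deriv_eq_zero (hδ : 0 < δ) (h : 1 + δ < t)
    (h' : t < 1 / δ ∨ 2 / δ < t) : profile δ t + t * deriv (profile δ) t = 0 := by
  have h1 : 1 < (t - 1) / δ := by rw [lt_div_iff₀ hδ]; linarith
  rw [profile_add_mul_deriv hδ (by linarith), deriv_smoothTransition_eq_zero (Or.inr h1),
    Real.smoothTransition.one_of_one_le h1.le, deriv_smoothTransition_eq_zero (x := δ * t - 1)]
  · simp
  · rw [lt_div_iff₀' hδ, div_lt_iff₀' hδ] at h'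
    rcases h' with h' | h'
    · left; linarith
    · right; linarith

/-- The product of the conformal part `f + t f'` and the anticonformal part `t f'` of the gradient
of `x ↦ f (|x|²) x` is small in the mean for `f = profile δ`. -/
theorem exists_profile_bound : ∃ M : ℝ, 0 < M ∧ ∀ δ t : ℝ, 0 < δ → δ ≤ 1 / 2 → 1 ≤ t →
    (profile δ t + t * deriv (profile δ) t) ^ 2 * (t * deriv (profile δ) t) ^ 2 ≤
      M * ((if t < 1 + 2 * δ then 1 else 0) + δ ^ 4 * (if t < 3 / δ then 1 else 0)) := by
  obtain ⟨C, hC0, hC⟩ := exists_abs_deriv_smoothTransition_le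
  refine ⟨((1 + C) * (2 + C)) ^ 2, by positivity, fun δ t hδ hδ2 ht => ?_⟩
  set α := profile δ t + t * deriv (profile δ) t with hα
  have hβ : t * deriv (profile δ) t = α - profile δ t := by rw [hα]; ring
  rw [hβ, ← mul_pow]
  have hf0 := profile_nonneg (δ := δ) ht
  have hf1 := profile_le_one (δ := δ) ht
  have hsq : ∀ {a b A B : ℝ}, |a| ≤ A → |b| ≤ B → (a * b) ^ 2 ≤ (A * B) ^ 2 :=
    fun {a b A B} ha hb => by
      refine sq_le_sq' ?_ ?_ <;>
      nlinarith [neg_abs_le (a * b), le_abs_self (a * b), abs_mul a b,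
        mul_le_mul ha hb (abs_nonneg b) ((abs_nonneg a).trans ha)]
  have hnn1 : (0 : ℝ) ≤ if t < 1 + 2 * δ then 1 else 0 := by split_ifs <;> norm_num
  have hnn2 : (0 : ℝ) ≤ if t < 3 / δ then 1 else 0 := by split_ifs <;> norm_num
  rcases le_or_gt t (1 + δ) with h | h
  · have hα1 : |α| ≤ 1 + C := by
      have hlow : δ * t - 1 < 0 := by nlinarith
      rw [hα, profile_add_mul_deriv hδ ht, deriv_smoothTransition_eq_zero (Or.inl hlow),
        Real.smoothTransition.zero_of_nonpos hlow.le]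
      -- The steep slope `1/δ` of the transition is compensated by the factor `t - 1 ≤ δ`.
      have h1 : |(t - 1) / δ * deriv Real.smoothTransition ((t - 1) / δ)| ≤ 1 * C := by
        rw [abs_mul]
        refine mul_le_mul ?_ (hC _) (abs_nonneg _) zero_le_one
        rw [abs_of_nonneg (div_nonneg (by linarith) hδ.le), div_le_one hδ]; linarith
      rw [abs_le] at h1 ⊢
      have := Real.smoothTransition.nonneg ((t - 1) / δ)
      have := Real.smoothTransition.le_one ((t - 1) / δ)
      simp only [sub_zero, mul_zero]
      constructor <;> linarith [h1.1, h1.2]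
    have hβ1 : |α - profile δ t| ≤ 2 + C := by
      rw [abs_le] at hα1 ⊢; constructor <;> linarith [hα1.1, hα1.2]
    refine (hsq hα1 hβ1).trans (le_mul_of_one_le_right (by positivity) ?_)
    rw [if_pos (by linarith)]
    have : 0 ≤ δ ^ 4 * if t < 3 / δ then (1 : ℝ) else 0 := by positivity
    linarith
  · by_cases h' : t < 1 / δ ∨ 2 / δ < t
    · rw [hα, profile_add_mul_deriv_eq_zero hδ h h']
      simp only [zero_mul, ne_eq, OfNat.ofNat_ne_zero, not_false_eq_true, zero_pow]
      positivity
    · push Not at h'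
      obtain ⟨h3, h4⟩ := h'
      have h1 : 1 < (t - 1) / δ := by rw [lt_div_iff₀ hδ]; linarith
      have hα1 : |α| ≤ δ * (1 + C) := by
        rw [hα, profile_add_mul_deriv hδ ht, deriv_smoothTransition_eq_zero (Or.inr h1),
          Real.smoothTransition.one_of_one_le h1.le]
        simp only [sub_self, mul_zero, zero_sub, mul_one, abs_neg, abs_mul, abs_of_pos hδ]
        exact mul_le_mul_of_nonneg_left ((hC _).trans (by linarith)) hδ.le
      -- In the cut-off region `f ≤ 1/t ≤ δ`, so both factors are `O(δ)` and the squared product is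
      -- `O(δ⁴)`.
      have hfδ : profile δ t ≤ δ := by
        rw [profile_of_ge_one_add hδ h.le, div_le_iff₀ (by linarith)]
        have : 1 ≤ δ * t := by rwa [div_le_iff₀' hδ] at h3
        linarith [Real.smoothTransition.nonneg (δ * t - 1)]
      have hβ1 : |α - profile δ t| ≤ δ * (2 + C) := by
        rw [abs_le] at hα1 ⊢; constructor <;> nlinarith [hα1.1, hα1.2]
      refine (hsq hα1 hβ1).trans ?_
      rw [if_pos (c := t < 3 / δ) (h4.trans_lt (div_lt_div_of_pos_right (by norm_num) hδ))]
      have : 0 ≤ ((1 + C) * (2 + C)) ^ 2 * if t < 1 + 2 * δ then (1 : ℝ) else 0 := by positivity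
      nlinarith

end Profile

/-! ### Radial functions and fields in the plane. -/

section PlaneFields

variable {Ω : Set (E 2)}

/-- The planar vector field with the given components. -/
noncomputable def pairField (a b : E 2 → ℝ) (x : E 2) : E 2 :=
  a x • EuclideanSpace.single 0 1 + b x • EuclideanSpace.single 1 1

theorem IsTest.pairField {a b : E 2 → ℝ} (ha : IsTest Ω a) (hb : IsTest Ω b) :
    IsTest Ω (pairField a b) :=
  (ha.comp_linear (ContinuousLinearMap.toSpanSingleton ℝ (EuclideanSpace.single 0 1 : E 2))).add
    (hb.comp_linear (ContinuousLinearMap.toSpanSingleton ℝ (EuclideanSpace.single 1 1 : E 2)))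

theorem IsTest.jacobian_pairField {a b : E 2 → ℝ} (ha : IsTest Ω a) (hb : IsTest Ω b) (x : E 2)
    (j : Fin 2) :
    jacobian (IntegralConvexity.pairField a b) x 0 j =
      fderiv ℝ a x (EuclideanSpace.single j 1) ∧
    jacobian (IntegralConvexity.pairField a b) x 1 j =
      fderiv ℝ b x (EuclideanSpace.single j 1) := by
  rw [(ha.pairField hb).jacobian_eq, (ha.pairField hb).jacobian_eq]
  constructor <;> congr 2 <;> ext y <;> simp [IntegralConvexity.pairField]

/-- `|x|²` -/
noncomputable def normSq (x : E 2) : ℝ := x 0 ^ 2 + x 1 ^ 2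

theorem normSq_eq (x : E 2) : normSq x = ‖x‖ ^ 2 := by
  rw [EuclideanSpace.real_norm_sq_eq, Fin.sum_univ_two, normSq]

theorem contDiff_coord (i : Fin 2) : ContDiff ℝ ∞ fun x : E 2 => x i :=
  (EuclideanSpace.proj i : E 2 →L[ℝ] ℝ).contDiff

theorem hasFDerivAt_coord (x : E 2) (i : Fin 2) :
    HasFDerivAt (fun x : E 2 => x i) (EuclideanSpace.proj i : E 2 →L[ℝ] ℝ) x :=
  (EuclideanSpace.proj i : E 2 →L[ℝ] ℝ).hasFDerivAt

theorem contDiff_normSq : ContDiff ℝ ∞ normSq :=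
  ((contDiff_coord 0).pow 2).add ((contDiff_coord 1).pow 2)

theorem fderiv_comp_normSq {f : ℝ → ℝ} (hf : Differentiable ℝ f) (x : E 2) (j : Fin 2) :
    fderiv ℝ (fun x => f (normSq x)) x (EuclideanSpace.single j 1) =
      2 * deriv f (normSq x) * x j := by
  have h1 : HasFDerivAt normSq _ x :=
    ((hasFDerivAt_coord x 0).pow 2).add ((hasFDerivAt_coord x 1).pow 2)
  have h2 : HasFDerivAt (fun x => f (normSq x)) _ x :=
    (hf (normSq x)).hasDerivAt.comp_hasFDerivAt x h1
  rw [h2.fderiv]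
  fin_cases j <;> simp <;> ring

theorem fderiv_coord (x : E 2) (i j : Fin 2) :
    fderiv ℝ (fun x : E 2 => x i) x (EuclideanSpace.single j 1) = if i = j then 1 else 0 := by
  rw [(hasFDerivAt_coord x i).fderiv]
  simp

theorem fderiv_mul_apply {a b : E 2 → ℝ} {x : E 2} (ha : DifferentiableAt ℝ a x)
    (hb : DifferentiableAt ℝ b x) (v : E 2) :
    fderiv ℝ (fun x => a x * b x) x v = a x * fderiv ℝ b x v + b x * fderiv ℝ a x v := by
  rw [fderiv_fun_mul ha hb]; simp

theorem fderiv_comp_normSq_mul {f : ℝ → ℝ} (hf : ContDiff ℝ ∞ f) {b : E 2 → ℝ}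
    (hb : ContDiff ℝ ∞ b) (x : E 2) (j : Fin 2) :
    fderiv ℝ (fun x => f (normSq x) * b x) x (EuclideanSpace.single j 1) =
      f (normSq x) * fderiv ℝ b x (EuclideanSpace.single j 1) +
        b x * (2 * deriv f (normSq x) * x j) := by
  have h : ContDiff ℝ ∞ fun x => f (normSq x) := hf.comp contDiff_normSq
  rw [fderiv_mul_apply (h.differentiable (by simp) x) (hb.differentiable (by simp) x),
    fderiv_comp_normSq (hf.differentiable (by simp))]

theorem isTest_comp_normSq_mul {f : ℝ → ℝ} (hf : ContDiff ℝ ∞ f) {T : ℝ}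
    (h0 : ∀ t, T ≤ t → f t = 0) {b : E 2 → ℝ} (hb : ContDiff ℝ ∞ b) :
    IsTest Set.univ fun x => f (normSq x) * b x := by
  refine ⟨(hf.comp contDiff_normSq).mul hb, HasCompactSupport.intro
    (isCompact_closedBall (0 : E 2) (Real.sqrt T)) fun x hx => ?_, Set.subset_univ _⟩
  rw [mem_closedBall_zero_iff, not_le] at hx
  rw [h0, zero_mul]
  rw [normSq_eq]
  exact (Real.sqrt_le_left (norm_nonneg x)).1 hx.le

theorem integral_indicator_ball_zero {r : ℝ} (hr : 0 ≤ r) :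
    Integrable ((Metric.ball (0 : E 2) r).indicator fun _ => (1 : ℝ)) ∧
    ∫ x, (Metric.ball (0 : E 2) r).indicator (fun _ => (1 : ℝ)) x = Real.pi * r ^ 2 := by
  constructor
  · exact (integrable_indicator_iff measurableSet_ball).2
      (integrableOn_const (measure_ball_lt_top.ne))
  · rw [integral_indicator_const _ measurableSet_ball, Measure.real,
      EuclideanSpace.volume_ball_fin_two]
    simp [ENNReal.toReal_ofReal hr, ENNReal.toReal_ofReal Real.pi_pos.le, mul_comm]

end PlaneFields

/-! ### Integral convexity forces `-2 ≤ k`. -/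

section LowerBound

/-- For `φ = (u, 0)` and `ψ = (0, v)` with `∇u ⟂ ∇v` the second variation is
`(2 + k) |∇u|² |∇v|²`. -/
theorem secondVar_of_orthogonal (k : ℝ) {J K : Mat 2 2} (hJ : ∀ j, J 1 j = 0)
    (hK : ∀ j, K 0 j = 0) (h : J 0 0 * K 1 0 + J 0 1 * K 1 1 = 0) :
    secondVar k J K = (2 + k) * ((J 0 0 ^ 2 + J 0 1 ^ 2) * (K 1 0 ^ 2 + K 1 1 ^ 2)) := by
  simp only [secondVar, frobInner_eq, detPolar, Matrix.det_fin_two, hJ, hK]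
  linear_combination (-k * (J 0 0 * K 1 0 + J 0 1 * K 1 1)) * h

theorem IntegralConvex.neg_two_le {Ω : Set (E 2)} (hΩ : IsOpen Ω) (hne : Ω.Nonempty) {k : ℝ}
    (hc : IntegralConvex Ω (g k)) : -2 ≤ k := by
  -- `w(|x|²)` is radial, and its gradient can be nonzero only for `2 ≤ |x|² ≤ 3`.
  set w : ℝ → ℝ := fun t => 1 - Real.smoothTransition (t - 2) with hw
  have hwd : ContDiff ℝ ∞ w := contDiff_const.sub
    (Real.smoothTransition.contDiff.comp (contDiff_id.sub contDiff_const))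
  have hw0 : ∀ t, 3 ≤ t → w t = 0 := fun t ht => by
    simp [hw, Real.smoothTransition.one_of_one_le (by linarith : 1 ≤ t - 2)]
  have hwderiv : ∀ t, deriv w t = -deriv Real.smoothTransition (t - 2) := fun t => by
    rw [hw, deriv_const_sub, deriv_comp_sub_const]
  -- Here `f(t) = 1/t` on `[5/4, 4]`, which contains `[2, 3]`. On that annulus `f(|x|²) x₀ x₁` is
  -- homogeneous of degree `0`, so its gradient is orthogonal to `x`, hence to the gradient of
  -- `w(|x|²)`.
  set f := profile (1 / 4) with hf
  have hfd : ContDiff ℝ ∞ f := contDiff_profile (by norm_num)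
  have hf0 : ∀ t, 8 ≤ t → f t = 0 := fun t ht =>
    profile_of_ge (by norm_num) (by norm_num) (by norm_num; exact ht)
  have hu : IsTest Set.univ fun x : E 2 => w (normSq x) := by
    simpa using isTest_comp_normSq_mul hwd hw0 (contDiff_const (c := (1 : ℝ)))
  have hm : ContDiff ℝ ∞ fun x : E 2 => x 0 * x 1 := (contDiff_coord 0).mul (contDiff_coord 1)
  have hv := isTest_comp_normSq_mul hfd hf0 hm
  have hz : IsTest Set.univ fun _ : E 2 => (0 : ℝ) :=
    ⟨contDiff_const, HasCompactSupport.zero, Set.subset_univ _⟩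
  have hux : ∀ (x : E 2) j, fderiv ℝ (fun x => w (normSq x)) x (EuclideanSpace.single j 1) =
      2 * deriv w (normSq x) * x j := fderiv_comp_normSq (hwd.differentiable (by simp))
  have hvx : ∀ (x : E 2) j, fderiv ℝ (fun x : E 2 => f (normSq x) * (x 0 * x 1)) x
      (EuclideanSpace.single j 1) =
        f (normSq x) * (x 0 * (if 1 = j then 1 else 0) + x 1 * (if 0 = j then 1 else 0)) +
          x 0 * x 1 * (2 * deriv f (normSq x) * x j) := fun x j => by
    rw [fderiv_comp_normSq_mul hfd hm, fderiv_mul_apply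
      ((contDiff_coord 0).differentiable (by simp) x)
      ((contDiff_coord 1).differentiable (by simp) x), fderiv_coord, fderiv_coord]
  have hnonneg := hc.integral_secondVar_nonneg_univ hΩ hne (hu.pairField hz) (hz.pairField hv)
  have horth : ∀ t, deriv w t * (f t + t * deriv f t) = 0 := by
    intro t
    by_cases ht : t - 2 < 0 ∨ 1 < t - 2
    · rw [hwderiv, deriv_smoothTransition_eq_zero ht]; simp
    · push Not at ht
      rw [hf, profile_add_mul_deriv_eq_zero (by norm_num) (by linarith)
        (Or.inl (by norm_num; linarith)), mul_zero]
  -- The product `|∇u|²|∇v|²`.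
  set h : E 2 → ℝ := fun x =>
    ((2 * deriv w (normSq x) * x 0) ^ 2 + (2 * deriv w (normSq x) * x 1) ^ 2) *
      ((f (normSq x) * x 1 + x 0 * x 1 * (2 * deriv f (normSq x) * x 0)) ^ 2 +
        (f (normSq x) * x 0 + x 0 * x 1 * (2 * deriv f (normSq x) * x 1)) ^ 2) with hh
  have hq : ∀ x, secondVar k (jacobian (pairField (fun x => w (normSq x)) fun _ => 0) x)
      (jacobian (pairField (fun _ => 0) fun x => f (normSq x) * (x 0 * x 1)) x) =
      (2 + k) * h x := by
    intro x
    have e1 := fun j => (hu.jacobian_pairField hz x j).1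
    have e2 := fun j => (hu.jacobian_pairField hz x j).2
    have e3 := fun j => (hz.jacobian_pairField hv x j).1
    have e4 := fun j => (hz.jacobian_pairField hv x j).2
    simp only [hux] at e1
    simp only [hvx] at e4
    rw [secondVar_of_orthogonal]
    · simp [e1, e4, hh]
    · intro j; rw [e2]; simp
    · intro j; rw [e3]; simp
    · simp only [e1, e4]
      simp only [zero_ne_one, one_ne_zero, if_true, if_false]
      have := horth (normSq x)
      have hn : normSq x = x 0 ^ 2 + x 1 ^ 2 := rfl
      linear_combination 4 * x 0 * x 1 * this -
        4 * x 0 * x 1 * deriv w (normSq x) * deriv f (normSq x) * hn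
  simp only [hq] at hnonneg
  rw [integral_const_mul] at hnonneg
  have hcw : Continuous (deriv w) := hwd.continuous_deriv (by simp)
  have hcf : Continuous (deriv f) := hfd.continuous_deriv (by simp)
  have hcn : Continuous normSq := contDiff_normSq.continuous
  have hcf' : Continuous f := hfd.continuous
  have hc0 : Continuous fun x : E 2 => x 0 := (contDiff_coord 0).continuous
  have hc1 : Continuous fun x : E 2 => x 1 := (contDiff_coord 1).continuous
  have hcont : Continuous h := by
    have := hcw.comp hcn
    have := hcf.comp hcn
    have := hcf'.comp hcn
    simp only [Function.comp_def] at *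
    rw [hh]; fun_prop
  -- The function `w` falls from `1` to `0` on `[2, 3]`, so `w' ≠ 0` somewhere inside. At the point
  -- `(√t, 0)` both gradients are then nonzero.
  obtain ⟨t, ht2, ht3, ht⟩ : ∃ t, 2 < t ∧ t < 3 ∧ deriv w t ≠ 0 := by
    obtain ⟨t, ht, he⟩ := exists_deriv_eq_slope w (by norm_num : (2 : ℝ) < 3)
      hwd.continuous.continuousOn (hwd.differentiable (by simp)).differentiableOn
    refine ⟨t, ht.1, ht.2, ?_⟩
    rw [he, hw0 3 le_rfl]
    norm_num [hw, Real.smoothTransition.zero_of_nonpos]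
  have hpos : 0 < ∫ x, h x := by
    have hsupp : HasCompactSupport h := by
      refine HasCompactSupport.intro (isCompact_closedBall (0 : E 2) 2) fun x hx => ?_
      rw [mem_closedBall_zero_iff, not_le] at hx
      have : 3 < normSq x := by rw [normSq_eq]; nlinarith
      simp [hh, hwderiv, deriv_smoothTransition_eq_zero (Or.inr (by linarith : 1 < normSq x - 2))]
    refine hcont.integral_pos_of_hasCompactSupport_nonneg_nonzero hsupp
      (fun x => by simp only [hh, Pi.zero_apply]; positivity)
      (x := EuclideanSpace.single 0 (Real.sqrt t)) ?_
    have hft : f t ≠ 0 := by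
      rw [hf, profile_of_ge_one_add (by norm_num) (by linarith),
        Real.smoothTransition.zero_of_nonpos (by linarith)]
      simp; linarith
    have hs : Real.sqrt t ^ 2 = t := Real.sq_sqrt (by linarith)
    have hs0 : Real.sqrt t ≠ 0 := (Real.sqrt_pos.2 (by linarith)).ne'
    have hn : normSq (EuclideanSpace.single 0 (Real.sqrt t)) = t := by simp [normSq, hs]
    simp [hh, hn, ht, hft, hs0]
  by_contra! hk
  nlinarith

end LowerBound

/-! ### Integral convexity forces `k ≤ 4`. -/

section UpperBound

/-- With `t = x² + y²`, the matrix `J` has conformal part `α = f + t d` and anticonformal part `β =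
t d`, so `det J = α² - β²`. Reversing the second row interchanges the two kinds of part. The only
angular dependence of the second variation is a negative square, which is dropped. -/
theorem secondVar_radial (k f d x y : ℝ) {J K : Mat 2 2}
    (h00 : J 0 0 = f + 2 * d * x ^ 2) (h01 : J 0 1 = 2 * d * x * y) (h10 : J 1 0 = 2 * d * x * y)
    (h11 : J 1 1 = f + 2 * d * y ^ 2) (hK0 : ∀ j, K 0 j = J 0 j) (hK1 : ∀ j, K 1 j = -J 1 j) :
    secondVar k J K ≤
      (8 - 2 * k) * ((f + (x ^ 2 + y ^ 2) * d) ^ 2 - ((x ^ 2 + y ^ 2) * d) ^ 2) ^ 2 +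
        96 * ((f + (x ^ 2 + y ^ 2) * d) ^ 2 * ((x ^ 2 + y ^ 2) * d) ^ 2) := by
  have : secondVar k J K =
      (8 - 2 * k) * ((f + (x ^ 2 + y ^ 2) * d) ^ 2 - ((x ^ 2 + y ^ 2) * d) ^ 2) ^ 2 +
        96 * ((f + (x ^ 2 + y ^ 2) * d) ^ 2 * ((x ^ 2 + y ^ 2) * d) ^ 2) -
        256 * ((f + (x ^ 2 + y ^ 2) * d) * d * x * y) ^ 2 := by
    simp only [secondVar, frobInner_eq, detPolar, Matrix.det_fin_two, hK0, hK1, h00, h01, h10, h11]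
    ring
  rw [this]
  linarith [sq_nonneg ((f + (x ^ 2 + y ^ 2) * d) * d * x * y)]

theorem IntegralConvex.le_four {Ω : Set (E 2)} (hΩ : IsOpen Ω) (hne : Ω.Nonempty) {k : ℝ}
    (hc : IntegralConvex Ω (g k)) : k ≤ 4 := by
  by_contra! hk
  obtain ⟨M, hM, hbound⟩ := exists_profile_bound
  -- The error below is `96 M (2δ + 3δ³) ≤ 480 M δ`, to be beaten by the gain `2 (k - 4)`.
  obtain ⟨δ, hδ, hδ2, hδM⟩ : ∃ δ : ℝ, 0 < δ ∧ δ ≤ 1 / 2 ∧ 480 * M * δ ≤ k - 4 := by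
    refine ⟨min (1 / 2) ((k - 4) / (480 * M)), lt_min (by norm_num)
      (div_pos (by linarith) (by positivity)), min_le_left _ _, ?_⟩
    have := min_le_right (1 / 2) ((k - 4) / (480 * M))
    rwa [le_div_iff₀' (by positivity)] at this
  set f := profile δ with hf
  have hfd : ContDiff ℝ ∞ f := contDiff_profile hδ
  have hf0 : ∀ t, 2 / δ ≤ t → f t = 0 := fun t ht => profile_of_ge hδ hδ2 ht
  have ha := isTest_comp_normSq_mul hfd hf0 (contDiff_coord 0)
  have hb := isTest_comp_normSq_mul hfd hf0 (contDiff_coord 1)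
  have hb' : IsTest Set.univ fun x : E 2 => -(f (normSq x) * x 1) := by
    simpa using hb.smul (-1)
  have hfx : ∀ (x : E 2) i j, fderiv ℝ (fun x : E 2 => f (normSq x) * x i) x
      (EuclideanSpace.single j 1) =
        f (normSq x) * (if i = j then 1 else 0) + x i * (2 * deriv f (normSq x) * x j) :=
    fun x i j => by rw [fderiv_comp_normSq_mul hfd (contDiff_coord i), fderiv_coord]
  have hφ := ha.pairField hb
  have hψ := ha.pairField hb'
  have hnonneg := hc.integral_secondVar_nonneg_univ hΩ hne hφ hψ
  have hle : ∀ x, secondVar k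
      (jacobian (pairField (fun x => f (normSq x) * x 0) fun x => f (normSq x) * x 1) x)
      (jacobian (pairField (fun x => f (normSq x) * x 0) fun x => -(f (normSq x) * x 1)) x) ≤
      (8 - 2 * k) * ((f (normSq x) + normSq x * deriv f (normSq x)) ^ 2 -
        (normSq x * deriv f (normSq x)) ^ 2) ^ 2 +
        96 * ((f (normSq x) + normSq x * deriv f (normSq x)) ^ 2 *
          (normSq x * deriv f (normSq x)) ^ 2) := by
    intro x
    have e1 := fun j => (ha.jacobian_pairField hb x j).1
    have e2 := fun j => (ha.jacobian_pairField hb x j).2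
    have e3 := fun j => (ha.jacobian_pairField hb' x j).1
    have e4 := fun j => (ha.jacobian_pairField hb' x j).2
    refine secondVar_radial k (f (normSq x)) (deriv f (normSq x)) (x 0) (x 1) ?_ ?_ ?_ ?_ ?_ ?_
    · rw [e1, hfx]; simp; ring
    · rw [e1, hfx]; simp; ring
    · rw [e2, hfx]; simp; ring
    · rw [e2, hfx]; simp; ring
    · intro j; rw [e1, e3]
    · intro j; rw [e2, e4, fderiv_fun_neg]; simp
  set I : ℝ → E 2 → ℝ := fun r => (Metric.ball (0 : E 2) r).indicator fun _ => (1 : ℝ) with hI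
  have hI1 : ∀ {x : E 2} {r : ℝ}, ‖x‖ < r → I r x = 1 := fun h =>
    Set.indicator_of_mem (mem_ball_zero_iff.2 h) _
  have hI0 : ∀ {x : E 2} {r : ℝ}, r ≤ ‖x‖ → I r x = 0 := fun h =>
    Set.indicator_of_notMem (fun h' => absurd (mem_ball_zero_iff.1 h') h.not_gt) _
  have hInn : ∀ (x : E 2) (r : ℝ), 0 ≤ I r x := fun x r =>
    Set.indicator_nonneg (fun _ _ => zero_le_one) x
  have hIif : ∀ (x : E 2) {s : ℝ}, 0 ≤ s →
      (if normSq x < s then (1 : ℝ) else 0) = I (Real.sqrt s) x := by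
    intro x s hs
    rw [normSq_eq]
    split_ifs with h
    · exact (hI1 (Real.lt_sqrt_of_sq_lt h)).symm
    · exact (hI0 ((Real.sqrt_le_left (norm_nonneg x)).2 (not_lt.1 h))).symm
  -- Inside the unit disc `α = 1` and `β = 0`, which gives `8 - 2k`. Outside it the first term is
  -- nonpositive and the product `α²β²` is controlled by `exists_profile_bound`. The coefficient
  -- `-96 M` removes the unit disc from the ball of radius `√(1 + 2δ)`.
  have hle' : ∀ x, secondVar k
      (jacobian (pairField (fun x => f (normSq x) * x 0) fun x => f (normSq x) * x 1) x)
      (jacobian (pairField (fun x => f (normSq x) * x 0) fun x => -(f (normSq x) * x 1)) x) ≤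
      (8 - 2 * k - 96 * M) * I 1 x + 96 * M * I (Real.sqrt (1 + 2 * δ)) x +
        96 * M * δ ^ 4 * I (Real.sqrt (3 / δ)) x + 0 * I 1 x := by
    intro x
    refine (hle x).trans ?_
    rcases lt_or_ge ‖x‖ 1 with hx | hx
    · have ht : normSq x < 1 := by rw [normSq_eq]; nlinarith [norm_nonneg x]
      have hd : deriv f (normSq x) = 0 := by
        have : f =ᶠ[𝓝 (normSq x)] fun _ => 1 := by
          filter_upwards [Iio_mem_nhds ht] with s hs
          exact profile_of_le_one hδ (le_of_lt hs)
        rw [this.deriv_eq, deriv_const]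
      rw [hd, hf, profile_of_le_one hδ ht.le, hI1 hx, ← hIif x (by positivity),
        if_pos (by linarith)]
      have := mul_nonneg (by positivity : 0 ≤ 96 * M * δ ^ 4) (hInn x (Real.sqrt (3 / δ)))
      linarith
    · have ht : 1 ≤ normSq x := by rw [normSq_eq]; nlinarith
      have := hbound δ (normSq x) hδ hδ2 ht
      rw [hIif x (by positivity), hIif x (by positivity)] at this
      rw [hI0 hx]
      have h1 : (8 - 2 * k) * ((f (normSq x) + normSq x * deriv f (normSq x)) ^ 2 -
        (normSq x * deriv f (normSq x)) ^ 2) ^ 2 ≤ 0 :=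
        mul_nonpos_of_nonpos_of_nonneg (by linarith) (sq_nonneg _)
      linarith
  have hT : ∀ {χ : E 2 → E 2}, IsTest Set.univ χ → ∀ i j,
      MemLp (fun x => jacobian χ x i j) 4 volume := fun h i j => by
    simpa using (h.jacobian_entry i j).memLp 4
  have hi := fun r (hr : (0 : ℝ) ≤ r) => integral_indicator_ball_zero hr
  obtain ⟨hB, hB'⟩ := integral_linearCombination (hi 1 zero_le_one).1
    (hi (Real.sqrt (1 + 2 * δ)) (Real.sqrt_nonneg _)).1
    (hi (Real.sqrt (3 / δ)) (Real.sqrt_nonneg _)).1 (hi 1 zero_le_one).1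
    (8 - 2 * k - 96 * M) (96 * M) (96 * M * δ ^ 4) 0
  have hfin := hnonneg.trans (integral_mono (integrable_secondVar k (hT hφ) (hT hψ)) hB hle')
  rw [hB', (hi 1 zero_le_one).2, (hi _ (Real.sqrt_nonneg _)).2, (hi _ (Real.sqrt_nonneg _)).2,
    Real.sq_sqrt (by positivity), Real.sq_sqrt (by positivity)] at hfin
  have hval : (8 - 2 * k - 96 * M) * (Real.pi * 1 ^ 2) + 96 * M * (Real.pi * (1 + 2 * δ)) +
      96 * M * δ ^ 4 * (Real.pi * (3 / δ)) + 0 * (Real.pi * 1 ^ 2) =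
      Real.pi * (8 - 2 * k + 96 * M * (2 * δ + 3 * δ ^ 3)) := by
    field_simp; ring
  rw [hval] at hfin
  have h3 : δ ^ 3 ≤ δ := by nlinarith [sq_nonneg δ]
  have : 8 - 2 * k + 96 * M * (2 * δ + 3 * δ ^ 3) < 0 := by
    nlinarith [mul_le_mul_of_nonneg_left h3 hM.le]
  nlinarith [Real.pi_pos]

end UpperBound

end IntegralConvexity

theorem proposition1p3 (Ω : Set (E 2)) (hΩo : IsOpen Ω) (hΩc : IsConnected Ω)
    (hΩb : Bornology.IsBounded Ω) (k : ℝ) :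
    -- quasimonotonicity of `Dg`, with the quantitative bound on `W₀^{1,4}`
    (0 ≤ k → k ≤ 8 →
      Quasimonotone (matGrad (g k)) ∧
      ∀ (ξ : Mat 2 2), ∀ φ ∈ W10 2 Ω 4,
        IntegrableOn (fun x => frobNorm (weakGrad Ω φ x) ^ 4) Ω ∧
        IntegrableOn
          (fun x => frobInner (matGrad (g k) (ξ + weakGrad Ω φ x)) (weakGrad Ω φ x)) Ω ∧
        (8 - k) / 8 * ∫ x in Ω, frobNorm (weakGrad Ω φ x) ^ 4 ≤
          ∫ x in Ω, frobInner (matGrad (g k) (ξ + weakGrad Ω φ x)) (weakGrad Ω φ x)) ∧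
    -- strong quasimonotonicity
    (0 ≤ k → k < 8 → StronglyQuasimonotone Ω 4 (matGrad (g k))) ∧
    -- the functional is finite on `W₀^{1,∞}`
    (∀ u ∈ W10 2 Ω ⊤, IntegrableOn (fun x => g k (weakGrad Ω u x)) Ω) ∧
    -- integral convexity
    (IntegralConvex Ω (g k) ↔ -2 ≤ k ∧ k ≤ 4) ∧
    (-2 ≤ k → k ≤ 4 → ConvexOn ℝ Set.univ (g k)) ∧
    -- quasimonotonicity does not imply integral convexity
    (4 < k → k ≤ 8 → Quasimonotone (matGrad (g k)) ∧ ¬ IntegralConvex Ω (g k)) := by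
  refine ⟨fun h0 h8 => ⟨quasimonotone_matGrad_g h0 h8, fun ξ φ hφ =>
      frobInner_matGrad_g_W10 hΩb h0 ξ hφ⟩, fun h0 h8 => stronglyQuasimonotone_matGrad_g hΩb h0 h8,
    fun u hu => integrableOn_g_weakGrad hΩb k hu,
    ⟨fun h => ⟨h.neg_two_le hΩo hΩc.nonempty, h.le_four hΩo hΩc.nonempty⟩,
      fun h => integralConvex_g hΩo hΩb h.1 h.2⟩, convexOn_g,
    fun h4 h8 => ⟨quasimonotone_matGrad_g (by linarith) h8,
      fun h => absurd (h.le_four hΩo hΩc.nonempty) (not_le.2 h4)⟩⟩
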